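/- Let $W,V:\mathbb R\to\mathbb R$ be strictly increasing, with $W$ right-continuous, $V$ left-continuous, and $W(x+1)-W(x)=W(1)-W(0)$, $V(x+1)-V(x)=V(1)-V(0)$ for all $x$. They induce finite Borel measures $dW$, $dV$ on $\mathbb T=\mathbb R/\mathbb Z$ (with $dW(a,b]=W(b)-W(a)$, $dV[a,b)=V(b)-V(a)$; atoms are allowed); write $L^2_W,L^2_V$ for the real $L^2$ spaces, $\langle\cdot,\cdot\rangle_V$ for the inner product of $L^2_V$, and $L^2_{W,0}=\{F\in L^2_W:\int_{\mathbb T}F\,dW=0\}$. For $f:\mathbb T\to\mathbb R$ put $D_W^-f(x)=\lim_{h\to0^-}\frac{f(x+h)-f(x)}{W(x+h)-W(x)}$ and $D_V^+f(x)=\lim_{h\to0^+}\frac{f(x+h)-f(x)}{V(x+h)-V(x)}$ when the limit exists for every $x\in\mathbb T$. "Càdlàg" means right-continuous with left limits, "càglàd" left-continuous with right limits. * $\mathfrak D_{W,V}(\mathbb T)$ is the set of càdlàg $f:\mathbb T\to\mathbb R$ such that $D_W^-f$ exists and is càglàd, and $D_V^+D_W^-f$ exists and is càdlàg. On it put $\|f\|_{1,2}^2=\langle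 f-D_V^+D_W^-f,f\rangle_V$. * $H_{W,V}(\mathbb T)$ is the set of $f\in L^2_V$ for which there are $f_n\in\mathfrak D_{W,V}(\mathbb T)$ with $f_n\to f$ in $L^2_V$ and $(f_n)$ Cauchy for $\|\cdot\|_{1,2}$. For $f\in H_{W,V}(\mathbb T)$, $D_W^-f$ denotes the unique $F\in L^2_{W,0}$ such that, for some constant $c$, $f(x)=c+\int_{(0,x]}F\,dW$ for $V$-a.e. $x$. * $C^\infty_{V,W,0}(\mathbb T)$ is the set of $g:\mathbb T\to\mathbb R$ such that all the iterated derivatives $g,\ D_V^+g,\ D_W^-D_V^+g,\ D_V^+D_W^-D_V^+g,\dots$ exist everywhere, those with an even number of factors (including $g$ itself) being càglàd with zero $dW$-integral and those with an odd number being càdlàg with zero $dV$-integral. $C^\infty_{V,W}(\mathbb T)$ is the sum of the constants and $C^\infty_{V,W,0}(\mathbb T)$. * $F\in L^2_W$ is a $W$-left weak derivative of $f\in L^2_V$ if $$\int_{\mathbb T}f\,D_V^+g\,dV=-\int_{\mathbb T}F\,g\,dW\qquad\text{for all }g\in C^\infty_{V,W}(\mathbb T),$$ and $\widetilde H_{W,V}(\mathbb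 T)$ is the set of $f\in L^2_V$ that have a $W$-left weak derivative in $L^2_{W,0}$. **Theorem.** $\widetilde H_{W,V}(\mathbb T)=H_{W,V}(\mathbb T)$. In particular, every $f\in H_{W,V}(\mathbb T)$ has exactly one $W$-left weak derivative $\partial_W^-f\in L^2_W$, and $\partial_W^-f=D_W^-f$. -/

import Mathlib

open MeasureTheory Filter Topology

noncomputable section

namespace OneSided

/-- The circle `𝕋 = ℝ / ℤ`. -/
abbrev Circ : Type := UnitAddCircle

/-- The pair `(W, V)`: strictly increasing functions on `ℝ` with periodic increments,
`W` right-continuous and `V` left-continuous (the other one-sided limits exist by monotonicity,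
so that `W` is càdlàg and `V` is càglàd). Both may have (common) jumps. -/
structure Weights where
  W : ℝ → ℝ
  V : ℝ → ℝ
  strictMono_W : StrictMono W
  strictMono_V : StrictMono V
  rightCont_W : ∀ x, ContinuousWithinAt W (Set.Ici x) x
  leftCont_V : ∀ x, ContinuousWithinAt V (Set.Iic x) x
  periodic_W : ∀ x, W (x + 1) - W x = W 1 - W 0
  periodic_V : ∀ x, V (x + 1) - V x = V 1 - V 0

/-- The Lebesgue–Stieltjes measure `dW` on `ℝ`, with `dW (a, b] = W b - W a`. -/
def Weights.dW (P : Weights) : Measure ℝ := P.strictMono_W.monotone.stieltjesFunction.measure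

/-- The Lebesgue–Stieltjes measure `dV` on `ℝ`, with `dV [a, b) = V b - V a`
(`Monotone.stieltjesFunction` passes to the right-continuous version of `V`, which has the
same jumps). -/
def Weights.dV (P : Weights) : Measure ℝ := P.strictMono_V.monotone.stieltjesFunction.measure

/-- The measure induced by `W` on the circle. -/
def Weights.μW (P : Weights) : Measure Circ :=
  (P.dW.restrict (Set.Ioc 0 1)).map (fun x : ℝ => (x : Circ))

/-- The measure induced by `V` on the circle. -/
def Weights.μV (P : Weights) : Measure Circ :=
  (P.dV.restrict (Set.Ioc 0 1)).map (fun x : ℝ => (x : Circ))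

/-- Right-continuous with left limits. -/
def Cadlag (f : Circ → ℝ) : Prop :=
  ∀ x : ℝ, ContinuousWithinAt (fun y : ℝ => f (y : Circ)) (Set.Ici x) x ∧
    ∃ l : ℝ, Tendsto (fun y : ℝ => f (y : Circ)) (𝓝[<] x) (𝓝 l)

/-- Left-continuous with right limits. -/
def Caglad (f : Circ → ℝ) : Prop :=
  ∀ x : ℝ, ContinuousWithinAt (fun y : ℝ => f (y : Circ)) (Set.Iic x) x ∧
    ∃ l : ℝ, Tendsto (fun y : ℝ => f (y : Circ)) (𝓝[>] x) (𝓝 l)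

/-- `F x` is the limit of `(f y - f x) / (φ y - φ x)` as `y → x` from the left, for all `x`. -/
def HasLeftDeriv (φ : ℝ → ℝ) (f F : Circ → ℝ) : Prop :=
  ∀ x : ℝ, Tendsto (fun y : ℝ => (f (y : Circ) - f (x : Circ)) / (φ y - φ x))
    (𝓝[<] x) (𝓝 (F (x : Circ)))

/-- `F x` is the limit of `(f y - f x) / (φ y - φ x)` as `y → x` from the right, for all `x`. -/
def HasRightDeriv (φ : ℝ → ℝ) (f F : Circ → ℝ) : Prop :=
  ∀ x : ℝ, Tendsto (fun y : ℝ => (f (y : Circ) - f (x : Circ)) / (φ y - φ x))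
    (𝓝[>] x) (𝓝 (F (x : Circ)))

/-- `f` is `φ`-left differentiable (at every point). -/
def LeftDifferentiable (φ : ℝ → ℝ) (f : Circ → ℝ) : Prop := ∃ F, HasLeftDeriv φ f F

/-- `f` is `φ`-right differentiable (at every point). -/
def RightDifferentiable (φ : ℝ → ℝ) (f : Circ → ℝ) : Prop := ∃ F, HasRightDeriv φ f F

open Classical in
/-- The classical left derivative `D_φ⁻ f` (only used where `f` is `φ`-left differentiable;
it is then the unique function with `HasLeftDeriv φ f`). -/
def leftDeriv (φ : ℝ → ℝ) (f : Circ → ℝ) : Circ → ℝ :=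
  if h : LeftDifferentiable φ f then Classical.choose h else 0

open Classical in
/-- The classical right derivative `D_φ⁺ f` (only used where `f` is `φ`-right differentiable;
it is then the unique function with `HasRightDeriv φ f`). -/
def rightDeriv (φ : ℝ → ℝ) (f : Circ → ℝ) : Circ → ℝ :=
  if h : RightDifferentiable φ f then Classical.choose h else 0

namespace Weights

variable (P : Weights)

/-- The domain `𝔇_{W,V}(𝕋)` of the strong operator `D_V⁺ D_W⁻`. -/
def strongDomain : Set (Circ → ℝ) :=
  {f | Cadlag f ∧ LeftDifferentiable P.W f ∧
    Caglad (leftDeriv P.W f) ∧ RightDifferentiable P.V (leftDeriv P.W f) ∧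
    Cadlag (rightDeriv P.V (leftDeriv P.W f))}

/-- The energetic norm `‖f‖_{1,2} = ⟨(I - D_V⁺ D_W⁻) f, f⟩_V ^ (1/2)`, for `f ∈ 𝔇_{W,V}(𝕋)`. -/
def energyNorm (f : Circ → ℝ) : ℝ :=
  Real.sqrt (∫ x, (f x - rightDeriv P.V (leftDeriv P.W f) x) * f x ∂P.μV)

/-- `u` is an admissible sequence for `f`: it lies in `𝔇_{W,V}(𝕋)`, converges to `f` in `L²_V`
and is Cauchy in the energetic norm. -/
def AdmissibleSeq (u : ℕ → Circ → ℝ) (f : Lp ℝ 2 P.μV) : Prop :=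
  (∀ n, u n ∈ P.strongDomain) ∧
  Tendsto (fun n => eLpNorm (fun x => u n x - f x) 2 P.μV) atTop (𝓝 0) ∧
  ∀ ε > 0, ∃ N, ∀ m ≥ N, ∀ n ≥ N, P.energyNorm (fun x => u m x - u n x) < ε

/-- The Sobolev space `H_{W,V}(𝕋)`: the energetic space of `I - D_V⁺ D_W⁻` on `𝔇_{W,V}(𝕋)`. -/
def sobolev : Set (Lp ℝ 2 P.μV) := {f | ∃ u, P.AdmissibleSeq u f}

/-- `F = D_W⁻ f` in the sense of `H_{W,V}(𝕋)`: `F ∈ L²_W` has mean zero and, for some constant `c`,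
`f(x) = c + ∫_{(0,x]} F dW` for `V`-almost every `x`. -/
def IsSobolevDeriv (f : Lp ℝ 2 P.μV) (F : Lp ℝ 2 P.μW) : Prop :=
  ∫ x, F x ∂P.μW = 0 ∧
  ∃ c : ℝ, ∀ᵐ x : ℝ ∂P.dV.restrict (Set.Ioc 0 1),
    f (x : Circ) = c + ∫ t in Set.Ioc 0 x, F (t : Circ) ∂P.dW

/-- The iterated derivatives `D^{(k)}_{V,W} = ⋯ D_V⁺ D_W⁻ D_V⁺` with `k` factors. -/
def iterDerivVW : ℕ → (Circ → ℝ) → Circ → ℝ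
  | 0, g => g
  | k + 1, g =>
    if Even k then rightDeriv P.V (iterDerivVW k g) else leftDeriv P.W (iterDerivVW k g)

/-- The derivative `D^{(k)}_{V,W} g` exists (everywhere), all lower ones included. -/
def IterDifferentiableVW (k : ℕ) (g : Circ → ℝ) : Prop :=
  ∀ j < k,
    if Even j then RightDifferentiable P.V (P.iterDerivVW j g)
    else LeftDifferentiable P.W (P.iterDerivVW j g)

/-- The càdlàg functions with `V`-mean zero. -/
def C0 : Set (Circ → ℝ) := {f | Cadlag f ∧ ∫ x, f x ∂P.μV = 0}

/-- The càglàd functions with `W`-mean zero. -/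
def C1 : Set (Circ → ℝ) := {f | Caglad f ∧ ∫ x, f x ∂P.μW = 0}

/-- The space `C^n_{V,W,0}(𝕋)`: the derivatives of even order `k ≤ n` (`k = 0` included) are
càglàd with `W`-mean zero, those of odd order are càdlàg with `V`-mean zero. -/
def CnVW0 (n : ℕ) : Set (Circ → ℝ) :=
  {g | ∀ k ≤ n, P.IterDifferentiableVW k g ∧
    P.iterDerivVW k g ∈ (if Even k then P.C1 else P.C0)}

/-- The space `C^∞_{V,W,0}(𝕋)`. -/
def CinftyVW0 : Set (Circ → ℝ) := ⋂ n, P.CnVW0 n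

/-- The space `C^∞_{V,W}(𝕋) = ⟨1⟩ ⊕ C^∞_{V,W,0}(𝕋)` of test functions. -/
def CinftyVW : Set (Circ → ℝ) :=
  {g | ∃ c : ℝ, ∃ g₀ ∈ P.CinftyVW0, g = fun x => c + g₀ x}

/-- `F ∈ L²_W` is a `W`-left weak derivative of `f ∈ L²_V`. -/
def IsWeakDeriv (f : Lp ℝ 2 P.μV) (F : Lp ℝ 2 P.μW) : Prop :=
  ∀ g ∈ P.CinftyVW, ∫ x, f x * rightDeriv P.V g x ∂P.μV = - ∫ x, F x * g x ∂P.μW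

/-- The space of `f ∈ L²_V` with a `W`-left weak derivative in `L²_{W,0}`. -/
def weakSobolev : Set (Lp ℝ 2 P.μV) :=
  {f | ∃ F : Lp ℝ 2 P.μW, ∫ x, F x ∂P.μW = 0 ∧ P.IsWeakDeriv f F}

end Weights

end OneSided

end

/-!
Both spaces turn out to be the set of those `f ∈ L²_V` that are, up to a constant, a primitive
`∫_{(0,x]} F dW` of some `F ∈ L²_{W,0}`.

Let `A : L²_W → L²_V` (`aOp` on functions, `aLp` on classes) send `F` to the mean-zero primitive of
its mean-zero part, and let `B` (`bOp`) be the analogous operator from `L²_V` to `L²_W`, built from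
the primitives `∫_{(0,x)} G dV`. Primitives have one-sided regularity and the expected one-sided
derivatives, and conversely `eq_primW_add_const` and `eq_primV_add_const` recover a function from
its everywhere defined one-sided derivative. By Fubini, `A† = -B` (`integral_aOp_mul`), and since
`dW` and `dV` have full support both operators are injective on functions of mean zero
(`center_ae_eq_zero_of_aOp`, `center_ae_eq_zero_of_bOp`).

*Test functions.* The operator `S F = ∫ F dW + A† A F` satisfies
`⟪S F, F⟫ = (∫ F dW)² + ‖A F‖²`, so it has dense range. A Mittag-Leffler argument
(`dense_backward_orbits`) shows that the `F` with an infinite backward orbit under `S` are dense.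
For such `F` the function `g = A† A F` belongs to `C^∞_{V,W,0}`, because each application of `S`
is undone, up to sign and constants, by `D_W⁻ D_V⁺`; moreover `D_V⁺ g = -A F`. This replaces the
spectral theory of `D_W⁻ D_V⁺`, and no compactness is needed.

*Weak derivatives.* If `F` is a weak derivative of `f`, testing with `1` gives `∫ F dW = 0`, and
testing with the functions above gives `⟪f - A F, A F'⟫ = 0` for a dense set of `F'`. Hence
`A† (f - A F) = 0`, so that `f - A F` is constant (`IsWeakDeriv.isSobolevDeriv`). The converse is
integration by parts. Uniqueness of both derivatives is the injectivity of `A`.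

*The energetic space.* Integration by parts turns the energetic norm into the graph norm of `D_W⁻`
(`IsStrong.energyNorm_eq`). The relation "`f` minus its mean equals `A F`" is closed and contains
this graph, so it also holds for limits of admissible sequences; conversely `c + A (S F')` lies in
`𝔇_{W,V}`, and the range of `S` is dense (`mem_sobolev_iff`).
-/

open MeasureTheory Filter Topology

noncomputable section

namespace OneSided

/-! ### One-sided limits and regularity on the line -/

theorem measurable_of_rightCont {f : ℝ → ℝ} (hf : ∀ x, ContinuousWithinAt f (Set.Ici x) x) :
    Measurable f := by
  -- sample `f` at the next point of the grid `ℤ / (n + 1)` strictly to the right of `x`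
  refine measurable_of_tendsto_metrizable
    (f := fun (n : ℕ) x => f ((⌊((n : ℝ) + 1) * x⌋ + 1) / ((n : ℝ) + 1))) (fun n => ?_) ?_
  · have h1 : Measurable fun k : ℤ => f (((k : ℝ) + 1) / ((n : ℝ) + 1)) := measurable_from_top
    exact h1.comp (Int.measurable_floor.comp (measurable_const.mul measurable_id))
  · rw [tendsto_pi_nhds]
    intro x
    refine (hf x).tendsto.comp (tendsto_nhdsWithin_iff.2 ⟨?_, ?_⟩)
    · have h0 : Tendsto (fun n : ℕ => x + 1 / ((n : ℝ) + 1)) atTop (𝓝 x) := by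
        simpa using tendsto_const_nhds.add (tendsto_one_div_add_atTop_nhds_zero_nat (𝕜 := ℝ))
      refine tendsto_of_tendsto_of_tendsto_of_le_of_le tendsto_const_nhds h0 ?_ ?_
      · intro n
        have hn : (0 : ℝ) < (n : ℝ) + 1 := by positivity
        simp only
        rw [le_div_iff₀ hn]
        nlinarith [Int.lt_floor_add_one (((n : ℝ) + 1) * x)]
      · intro n
        have hn : (0 : ℝ) < (n : ℝ) + 1 := by positivity
        simp only
        rw [div_le_iff₀ hn, add_mul x, one_div, inv_mul_cancel₀ hn.ne']
        nlinarith [Int.floor_le (((n : ℝ) + 1) * x)]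
    · refine Eventually.of_forall fun n => ?_
      have hn : (0 : ℝ) < (n : ℝ) + 1 := by positivity
      simp only [Set.mem_Ici]
      rw [le_div_iff₀ hn]
      nlinarith [Int.lt_floor_add_one (((n : ℝ) + 1) * x)]

theorem rightCont_comp_neg {f : ℝ → ℝ} (hf : ∀ x, ContinuousWithinAt f (Set.Iic x) x) (x : ℝ) :
    ContinuousWithinAt (fun y => f (-y)) (Set.Ici x) x :=
  (hf (-x)).comp continuous_neg.continuousWithinAt fun y (hy : x ≤ y) => by
    simpa using hy

theorem measurable_of_leftCont {f : ℝ → ℝ} (hf : ∀ x, ContinuousWithinAt f (Set.Iic x) x) :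
    Measurable f := by
  simpa [Function.comp_def] using
    (measurable_of_rightCont (rightCont_comp_neg hf)).comp measurable_neg

/-- A function with one-sided limits at every point is bounded on compact sets. -/
theorem exists_bound_of_oneSided_limits {f : ℝ → ℝ}
    (hl : ∀ x, ∃ l, Tendsto f (𝓝[<] x) (𝓝 l)) (hr : ∀ x, ∃ l, Tendsto f (𝓝[>] x) (𝓝 l))
    {K : Set ℝ} (hK : IsCompact K) : ∃ C, ∀ x ∈ K, |f x| ≤ C := by
  refine hK.induction_on (p := fun s => ∃ C, ∀ x ∈ s, |f x| ≤ C) ⟨0, by simp⟩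
    (fun s t hst ⟨C, hC⟩ => ⟨C, fun x hx => hC x (hst hx)⟩)
    (fun s t ⟨C, hC⟩ ⟨D, hD⟩ => ⟨max C D, ?_⟩) fun x _ => ?_
  · rintro x (hx | hx)
    · exact (hC x hx).trans (le_max_left _ _)
    · exact (hD x hx).trans (le_max_right _ _)
  · obtain ⟨l, hl⟩ := hl x
    obtain ⟨r, hr⟩ := hr x
    have h1 := hl.abs.eventually (gt_mem_nhds (lt_add_one |l|))
    have h2 := hr.abs.eventually (gt_mem_nhds (lt_add_one |r|))
    have h3 : ∀ᶠ y in 𝓝 x, |f y| ≤ max (|f x|) (max (|l| + 1) (|r| + 1)) := by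
      rw [← nhdsNE_sup_pure, ← nhdsLT_sup_nhdsGT, eventually_sup, eventually_sup]
      refine ⟨⟨h1.mono fun y hy => ?_, h2.mono fun y hy => ?_⟩, ?_⟩
      · exact hy.le.trans (le_max_of_le_right (le_max_left _ _))
      · exact hy.le.trans (le_max_of_le_right (le_max_right _ _))
      · simp
    exact ⟨_, mem_nhdsWithin_of_mem_nhds h3, _, fun y hy => hy⟩

/-! ### Increments of primitives -/

section Primitives

variable {m : Measure ℝ} {F f φ : ℝ → ℝ}

/-- Dominated convergence for the integrals of a fixed function over sets that converge
pointwise. -/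
theorem tendsto_setIntegral_of_eventually_mem_iff {l : Filter ℝ} [l.IsCountablyGenerated]
    {K s₀ : Set ℝ} {s : ℝ → Set ℝ} (hF : IntegrableOn F K m) (hs : ∀ y, MeasurableSet (s y))
    (hs₀ : MeasurableSet s₀) (hK : ∀ᶠ y in l, s y ⊆ K) (hK₀ : s₀ ⊆ K)
    (h : ∀ t, ∀ᶠ y in l, (t ∈ s y ↔ t ∈ s₀)) :
    Tendsto (fun y => ∫ t in s y, F t ∂m) l (𝓝 (∫ t in s₀, F t ∂m)) := by
  have key : Tendsto (fun y => ∫ t in K, (s y).indicator F t ∂m) l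
      (𝓝 (∫ t in K, s₀.indicator F t ∂m)) := by
    refine tendsto_integral_filter_of_dominated_convergence (fun t => ‖F t‖) ?_ ?_ hF.norm ?_
    · exact Eventually.of_forall fun y => hF.aestronglyMeasurable.indicator (hs y)
    · exact Eventually.of_forall fun y =>
        Eventually.of_forall fun t => norm_indicator_le_norm_self _ _
    · refine Eventually.of_forall fun t => ?_
      refine tendsto_const_nhds.congr' ((h t).mono fun y hy => ?_)
      by_cases ht : t ∈ s₀
      · simp only
        rw [Set.indicator_of_mem ht, Set.indicator_of_mem (hy.2 ht)]
      · simp only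
        rw [Set.indicator_of_notMem ht, Set.indicator_of_notMem (fun h' => ht (hy.1 h'))]
  have e : ∀ u : Set ℝ, MeasurableSet u → u ⊆ K →
      ∫ t in K, u.indicator F t ∂m = ∫ t in u, F t ∂m := fun u hu huK => by
    rw [setIntegral_indicator hu, Set.inter_eq_self_of_subset_right huK]
  rw [e s₀ hs₀ hK₀] at key
  exact key.congr' (hK.mono fun y hy => e _ (hs y) hy)

/-- `f` is a primitive of `F` with increments over the intervals `(a, b]`. -/
def IsPrimIoc (m : Measure ℝ) (F f : ℝ → ℝ) : Prop :=
  ∀ a b, a ≤ b → f b - f a = ∫ t in Set.Ioc a b, F t ∂m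

/-- `f` is a primitive of `F` with increments over the intervals `[a, b)`. -/
def IsPrimIco (m : Measure ℝ) (F f : ℝ → ℝ) : Prop :=
  ∀ a b, a ≤ b → f b - f a = ∫ t in Set.Ico a b, F t ∂m

theorem eventually_mem_Ioo_right (x : ℝ) : ∀ᶠ y in 𝓝[>] x, y ∈ Set.Ioo x (x + 1) :=
  Ioo_mem_nhdsGT (by linarith)

theorem eventually_mem_Ioo_left (x : ℝ) : ∀ᶠ y in 𝓝[<] x, y ∈ Set.Ioo (x - 1) x :=
  Ioo_mem_nhdsLT (by linarith)

theorem eventually_gt_of_lt {x t : ℝ} (h : x < t) : ∀ᶠ y in 𝓝[>] x, y < t :=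
  mem_nhdsWithin_of_mem_nhds (Iio_mem_nhds h)

theorem eventually_lt_of_gt {x t : ℝ} (h : t < x) : ∀ᶠ y in 𝓝[<] x, t < y :=
  mem_nhdsWithin_of_mem_nhds (Ioi_mem_nhds h)

theorem IsPrimIoc.rightCont (hp : IsPrimIoc m F f)
    (hF : ∀ a b, IntegrableOn F (Set.Icc a b) m) (x : ℝ) :
    ContinuousWithinAt f (Set.Ici x) x := by
  rw [← continuousWithinAt_Ioi_iff_Ici]
  have h := tendsto_setIntegral_of_eventually_mem_iff (l := 𝓝[>] x) (s := fun y => Set.Ioc x y)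
    (s₀ := ∅) (hF x (x + 1)) (fun y => measurableSet_Ioc) MeasurableSet.empty
    ((eventually_mem_Ioo_right x).mono fun y hy t ht => ⟨ht.1.le, ht.2.trans hy.2.le⟩)
    (Set.empty_subset _) (fun t => ?_)
  · have h2 := h.const_add (f x)
    simp only [Measure.restrict_empty, integral_zero_measure, add_zero] at h2
    refine h2.congr' ((eventually_mem_Ioo_right x).mono fun y hy => ?_)
    rw [← hp x y hy.1.le]; ring
  · simp only [Set.mem_empty_iff_false, iff_false]
    rcases le_or_gt t x with ht | ht
    · exact Eventually.of_forall fun y hy => absurd hy.1 (not_lt.2 ht)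
    · exact (eventually_gt_of_lt ht).mono fun y hy h => absurd h.2 (not_le.2 hy)

theorem IsPrimIoc.leftLim (hp : IsPrimIoc m F f)
    (hF : ∀ a b, IntegrableOn F (Set.Icc a b) m) (x : ℝ) :
    ∃ l, Tendsto f (𝓝[<] x) (𝓝 l) := by
  have h := tendsto_setIntegral_of_eventually_mem_iff (l := 𝓝[<] x) (s := fun y => Set.Ioc y x)
    (s₀ := {x}) (hF (x - 1) x) (fun y => measurableSet_Ioc) (measurableSet_singleton x)
    ((eventually_mem_Ioo_left x).mono fun y hy t ht => ⟨hy.1.le.trans ht.1.le, ht.2⟩)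
    (by simp) (fun t => ?_)
  · refine ⟨_, (h.const_sub (f x)).congr' ((eventually_mem_Ioo_left x).mono fun y hy => ?_)⟩
    rw [← hp y x hy.2.le]; ring
  · simp only [Set.mem_singleton_iff]
    rcases lt_trichotomy t x with ht | ht | ht
    · exact (eventually_lt_of_gt ht).mono fun y hy =>
        ⟨fun h => absurd h.1 (not_lt.2 hy.le), fun h => absurd h ht.ne⟩
    · exact (eventually_mem_Ioo_left x).mono fun y hy =>
        ⟨fun _ => ht, fun _ => by subst ht; exact ⟨hy.2, le_rfl⟩⟩
    · exact Eventually.of_forall fun y =>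
        ⟨fun h => absurd h.2 (not_le.2 ht), fun h => absurd h ht.ne'⟩

theorem IsPrimIco.leftCont (hp : IsPrimIco m F f)
    (hF : ∀ a b, IntegrableOn F (Set.Icc a b) m) (x : ℝ) :
    ContinuousWithinAt f (Set.Iic x) x := by
  rw [← continuousWithinAt_Iio_iff_Iic]
  have h := tendsto_setIntegral_of_eventually_mem_iff (l := 𝓝[<] x) (s := fun y => Set.Ico y x)
    (s₀ := ∅) (hF (x - 1) x) (fun y => measurableSet_Ico) MeasurableSet.empty
    ((eventually_mem_Ioo_left x).mono fun y hy t ht => ⟨hy.1.le.trans ht.1, ht.2.le⟩)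
    (Set.empty_subset _) (fun t => ?_)
  · have h2 := h.const_sub (f x)
    simp only [Measure.restrict_empty, integral_zero_measure, sub_zero] at h2
    refine h2.congr' ((eventually_mem_Ioo_left x).mono fun y hy => ?_)
    rw [← hp y x hy.2.le]; ring
  · simp only [Set.mem_empty_iff_false, iff_false]
    rcases lt_or_ge t x with ht | ht
    · exact (eventually_lt_of_gt ht).mono fun y hy h => absurd h.1 (not_le.2 hy)
    · exact Eventually.of_forall fun y hy => absurd hy.2 (not_lt.2 ht)

theorem IsPrimIco.rightLim (hp : IsPrimIco m F f)
    (hF : ∀ a b, IntegrableOn F (Set.Icc a b) m) (x : ℝ) :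
    ∃ l, Tendsto f (𝓝[>] x) (𝓝 l) := by
  have h := tendsto_setIntegral_of_eventually_mem_iff (l := 𝓝[>] x) (s := fun y => Set.Ico x y)
    (s₀ := {x}) (hF x (x + 1)) (fun y => measurableSet_Ico) (measurableSet_singleton x)
    ((eventually_mem_Ioo_right x).mono fun y hy t ht => ⟨ht.1, ht.2.le.trans hy.2.le⟩)
    (by simp) (fun t => ?_)
  · refine ⟨_, (h.const_add (f x)).congr' ((eventually_mem_Ioo_right x).mono fun y hy => ?_)⟩
    rw [← hp x y hy.1.le]; ring
  · simp only [Set.mem_singleton_iff]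
    rcases lt_trichotomy t x with ht | ht | ht
    · exact Eventually.of_forall fun y =>
        ⟨fun h => absurd h.1 (not_le.2 ht), fun h => absurd h ht.ne⟩
    · exact (eventually_mem_Ioo_right x).mono fun y hy =>
        ⟨fun _ => ht, fun _ => by subst ht; exact ⟨le_rfl, hy.1⟩⟩
    · exact (eventually_gt_of_lt ht).mono fun y hy =>
        ⟨fun h => absurd h.2 (not_lt.2 hy.le), fun h => absurd h ht.ne'⟩

/-! ### Differentiation of primitives -/

/-- The average of `F` over `s` is within `ε` of `L` if `F` is within `ε` of `L` on `s`. -/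
theorem abs_setIntegral_div_sub_le {s : Set ℝ} {L ε : ℝ}
    (hpos : 0 < m.real s) (hF : IntegrableOn F s m) (h : ∀ t ∈ s, |F t - L| ≤ ε) :
    |(∫ t in s, F t ∂m) / m.real s - L| ≤ ε := by
  have hfin : m s < ⊤ := by
    by_contra hh
    simp [Measure.real, top_le_iff.1 (not_lt.1 hh)] at hpos
  have h1 : ∫ t in s, (F t - L) ∂m = (∫ t in s, F t ∂m) - L * m.real s := by
    rw [integral_sub hF (integrableOn_const hfin.ne)]
    simp [mul_comm]
  have h2 := norm_setIntegral_le_of_norm_le_const (f := fun t => F t - L) hfin h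
  rw [h1, Real.norm_eq_abs] at h2
  have h3 : (∫ t in s, F t ∂m) / m.real s - L = ((∫ t in s, F t ∂m) - L * m.real s) / m.real s := by
    field_simp
  rw [h3, abs_div, abs_of_pos hpos, div_le_iff₀ hpos]
  exact h2

theorem IsPrimIoc.tendsto_slope (hp : IsPrimIoc m F f)
    (hF : ∀ a b, IntegrableOn F (Set.Icc a b) m) (hφ : StrictMono φ)
    (hm : ∀ a b, a ≤ b → m.real (Set.Ioc a b) = φ b - φ a) {x : ℝ}
    (hx : ContinuousWithinAt F (Set.Iic x) x) :
    Tendsto (fun y => (f y - f x) / (φ y - φ x)) (𝓝[<] x) (𝓝 (F x)) := by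
  rw [Metric.tendsto_nhds]
  intro ε hε
  obtain ⟨δ, hδ, h⟩ := Metric.continuousWithinAt_iff.1 hx (ε / 2) (half_pos hε)
  filter_upwards [self_mem_nhdsWithin, eventually_lt_of_gt (show x - δ < x by linarith)]
    with y hy hy2
  have hy : y < x := hy
  have e : (f y - f x) / (φ y - φ x) = (∫ t in Set.Ioc y x, F t ∂m) / m.real (Set.Ioc y x) := by
    rw [← hp y x hy.le, hm y x hy.le, ← neg_sub, ← neg_sub (φ x), neg_div_neg_eq]
  rw [e, Real.dist_eq]
  refine lt_of_le_of_lt (abs_setIntegral_div_sub_le ?_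
    ((hF y x).mono_set Set.Ioc_subset_Icc_self) fun t ht => ?_) (half_lt_self hε)
  · rw [hm y x hy.le]; exact sub_pos.2 (hφ hy)
  · refine (h ht.2 ?_).le
    rw [Real.dist_eq, abs_lt]; constructor <;> linarith [ht.1, ht.2]

theorem IsPrimIco.tendsto_slope (hp : IsPrimIco m F f)
    (hF : ∀ a b, IntegrableOn F (Set.Icc a b) m) (hφ : StrictMono φ)
    (hm : ∀ a b, a ≤ b → m.real (Set.Ico a b) = φ b - φ a) {x : ℝ}
    (hx : ContinuousWithinAt F (Set.Ici x) x) :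
    Tendsto (fun y => (f y - f x) / (φ y - φ x)) (𝓝[>] x) (𝓝 (F x)) := by
  rw [Metric.tendsto_nhds]
  intro ε hε
  obtain ⟨δ, hδ, h⟩ := Metric.continuousWithinAt_iff.1 hx (ε / 2) (half_pos hε)
  filter_upwards [self_mem_nhdsWithin, eventually_gt_of_lt (show x < x + δ by linarith)]
    with y hy hy2
  have hy : x < y := hy
  rw [hp x y hy.le, ← hm x y hy.le, Real.dist_eq]
  refine lt_of_le_of_lt (abs_setIntegral_div_sub_le ?_
    ((hF x y).mono_set Set.Ico_subset_Icc_self) fun t ht => ?_) (half_lt_self hε)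
  · rw [hm x y hy.le]; exact sub_pos.2 (hφ hy)
  · refine (h ht.1 ?_).le
    rw [Real.dist_eq, abs_lt]; constructor <;> linarith [ht.1, ht.2]

end Primitives

/-! ### Functions with vanishing one-sided derivative -/

/-- Continuous induction from `b` down to `a`: the estimate passes to decreasing limits by right
continuity, and extends to the left of any point by the derivative condition there. -/
theorem abs_sub_le_of_leftSlope_tendsto_zero {φ h : ℝ → ℝ} (hφ : StrictMono φ)
    (hφc : ∀ x, ContinuousWithinAt φ (Set.Ici x) x) (hc : ∀ x, ContinuousWithinAt h (Set.Ici x) x)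
    (hd : ∀ x, Tendsto (fun y => (h y - h x) / (φ y - φ x)) (𝓝[<] x) (𝓝 0))
    {a b : ℝ} (hab : a ≤ b) {ε : ℝ} (hε : 0 < ε) : |h b - h a| ≤ ε * (φ b - φ a) := by
  set S : Set ℝ := {y | y ∈ Set.Icc a b ∧ |h b - h y| ≤ ε * (φ b - φ y)} with hS
  have hbS : b ∈ S := ⟨⟨hab, le_rfl⟩, by simp⟩
  have hbdd : BddBelow S := ⟨a, fun y hy => hy.1.1⟩
  have hne : S.Nonempty := ⟨b, hbS⟩
  set s := sInf S
  have hsa : a ≤ s := le_csInf hne fun y hy => hy.1.1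
  have hsb : s ≤ b := csInf_le hbdd hbS
  -- right continuity of `h` and `φ` makes `S` closed under decreasing limits
  have hsS : s ∈ S := by
    refine ⟨⟨hsa, hsb⟩, ?_⟩
    by_contra hcon
    rw [not_le] at hcon
    have h1 : ContinuousWithinAt (fun y => |h b - h y| - ε * (φ b - φ y)) (Set.Ici s) s :=
      ((continuousWithinAt_const.sub (hc s)).abs).sub
        (continuousWithinAt_const.mul (continuousWithinAt_const.sub (hφc s)))
    have h2 := h1.tendsto.eventually (lt_mem_nhds (sub_pos.2 hcon))
    obtain ⟨u, hu, h3⟩ := mem_nhdsGE_iff_exists_Ico_subset.1 h2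
    obtain ⟨y, hyS, hyu⟩ := exists_lt_of_csInf_lt hne hu
    have h4 : 0 < |h b - h y| - ε * (φ b - φ y) := h3 ⟨csInf_le hbdd hyS, hyu⟩
    linarith [hyS.2]
  rcases hsa.eq_or_lt with hs | hs
  · rw [← hs] at hsS; exact hsS.2
  · exfalso
    have h1 := (hd s).abs.eventually (gt_mem_nhds (show |(0 : ℝ)| < ε by simpa))
    obtain ⟨y, hy1, hy2, hy3⟩ :=
      (h1.and ((eventually_lt_of_gt hs).and self_mem_nhdsWithin)).exists
    have hy3 : y < s := hy3
    have hφy := hφ hy3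
    rw [abs_div, abs_sub_comm (φ y), abs_of_pos (sub_pos.2 hφy), div_lt_iff₀ (sub_pos.2 hφy),
      abs_sub_comm] at hy1
    have hyS : y ∈ S := by
      refine ⟨⟨hy2.le, hy3.le.trans hsb⟩, ?_⟩
      have h5 : h b - h y = (h b - h s) + (h s - h y) := by ring
      rw [h5]
      refine (abs_add_le _ _).trans ?_
      linarith [hsS.2]
    exact absurd (csInf_le hbdd hyS) (not_le.2 hy3)

/-- A right-continuous function whose left derivative with respect to a strictly increasing
right-continuous `φ` vanishes everywhere is constant. -/
theorem eq_of_leftSlope_tendsto_zero {φ h : ℝ → ℝ} (hφ : StrictMono φ)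
    (hφc : ∀ x, ContinuousWithinAt φ (Set.Ici x) x) (hc : ∀ x, ContinuousWithinAt h (Set.Ici x) x)
    (hd : ∀ x, Tendsto (fun y => (h y - h x) / (φ y - φ x)) (𝓝[<] x) (𝓝 0)) (a b : ℝ) :
    h a = h b := by
  wlog hab : a ≤ b generalizing a b
  · exact (this b a (le_of_not_ge hab)).symm
  have h1 : Tendsto (fun ε : ℝ => ε * (φ b - φ a)) (𝓝[>] 0) (𝓝 (0 * (φ b - φ a))) :=
    (tendsto_nhdsWithin_of_tendsto_nhds tendsto_id).mul_const _
  rw [zero_mul] at h1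
  have h2 : |h b - h a| ≤ 0 := ge_of_tendsto h1 <| by
    filter_upwards [self_mem_nhdsWithin] with ε hε
    exact abs_sub_le_of_leftSlope_tendsto_zero hφ hφc hc hd hab hε
  linarith [abs_nonpos_iff.1 h2]

theorem eq_of_rightSlope_tendsto_zero {φ h : ℝ → ℝ} (hφ : StrictMono φ)
    (hφc : ∀ x, ContinuousWithinAt φ (Set.Iic x) x) (hc : ∀ x, ContinuousWithinAt h (Set.Iic x) x)
    (hd : ∀ x, Tendsto (fun y => (h y - h x) / (φ y - φ x)) (𝓝[>] x) (𝓝 0)) (a b : ℝ) :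
    h a = h b := by
  have := eq_of_leftSlope_tendsto_zero (φ := fun y => -φ (-y)) (h := fun y => h (-y))
    (fun x y hxy => neg_lt_neg (hφ (neg_lt_neg hxy))) (fun x => (rightCont_comp_neg hφc x).neg)
    (rightCont_comp_neg hc) (fun x => ?_) (-a) (-b)
  · simpa using this
  · have h1 : Tendsto (fun y : ℝ => -y) (𝓝[<] x) (𝓝[>] (-x)) := tendsto_neg_nhdsLT
    have h2 := ((hd (-x)).comp h1).neg
    rw [neg_zero] at h2
    refine h2.congr fun y => ?_
    simp only [Function.comp]
    rw [← div_neg]; congr 1; ring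

/-! ### Periodic primitives -/

section Periodic

variable {m : Measure ℝ} {F : ℝ → ℝ}

theorem integrableOn_shift_iff (hm : m.map (fun x => x + 1) = m) (hF : ∀ x, F (x + 1) = F x)
    (a b : ℝ) : IntegrableOn F (Set.Ioc (a + 1) (b + 1)) m ↔ IntegrableOn F (Set.Ioc a b) m := by
  have e : MeasurableEmbedding (fun x : ℝ => x + 1) := measurableEmbedding_addRight 1
  have h := e.integrableOn_map_iff (μ := m) (f := F) (s := Set.Ioc (a + 1) (b + 1))
  rw [hm] at h
  rw [h]
  have : F ∘ (fun x : ℝ => x + 1) = F := funext hF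
  rw [this]
  simp

theorem setIntegral_shift (hm : m.map (fun x => x + 1) = m) (hF : ∀ x, F (x + 1) = F x)
    (s : Set ℝ) : ∫ t in s, F t ∂m = ∫ t in (fun x => x + 1) ⁻¹' s, F t ∂m := by
  have e : MeasurableEmbedding (fun x : ℝ => x + 1) := measurableEmbedding_addRight 1
  have h := e.setIntegral_map (μ := m) F s
  rw [hm] at h
  rw [h]
  simp only [hF]

theorem integrableOn_Icc_of_periodic [IsLocallyFiniteMeasure m]
    (hm : m.map (fun x => x + 1) = m) (hF : ∀ x, F (x + 1) = F x)
    (h : IntegrableOn F (Set.Ioc 0 1) m) (a b : ℝ) : IntegrableOn F (Set.Icc a b) m := by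
  have key : ∀ n : ℕ, IntegrableOn F (Set.Ioc (-(n : ℝ) - 1) (n + 1)) m := by
    intro n
    induction n with
    | zero =>
      have h1 : IntegrableOn F (Set.Ioc (-1) 0) m := by
        rw [← integrableOn_shift_iff hm hF]; simpa using h
      refine (h1.union h).mono_set fun x hx => ?_
      rcases le_or_gt x 0 with h0 | h0
      · exact Or.inl ⟨by simpa using hx.1, h0⟩
      · exact Or.inr ⟨h0, by simpa using hx.2⟩
    | succ n ih =>
      have h1 : IntegrableOn F (Set.Ioc (-(n : ℝ) - 1 - 1) (n + 1 - 1)) m := by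
        rw [← integrableOn_shift_iff hm hF]; simpa using ih
      have h2 : IntegrableOn F (Set.Ioc (-(n : ℝ) - 1 + 1) (n + 1 + 1)) m :=
        (integrableOn_shift_iff hm hF _ _).2 ih
      refine ((h1.union h2).union ih).mono_set fun x hx => ?_
      push_cast at hx
      have hn : (0 : ℝ) ≤ n := n.cast_nonneg
      simp only [Set.mem_union, Set.mem_Ioc] at hx ⊢
      rcases le_or_gt x ((n : ℝ) + 1 - 1) with h0 | h0
      · left; left; constructor <;> linarith
      · left; right; constructor <;> linarith
  obtain ⟨n, hn⟩ := exists_nat_ge (max |a| |b|)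
  refine (key n).mono_set fun x hx => ?_
  have h1 := (abs_le.1 ((le_max_left |a| |b|).trans hn)).1
  have h2 := (abs_le.1 ((le_max_right |a| |b|).trans hn)).2
  exact ⟨by linarith [hx.1], by linarith [hx.2]⟩

/-- The primitive `x ↦ ∫_{(0, x]} F dm`, with the usual sign for `x < 0`. -/
def lowPrim (m : Measure ℝ) (F : ℝ → ℝ) (x : ℝ) : ℝ := ∫ t in (0 : ℝ)..x, F t ∂m

/-- The left-continuous version of `lowPrim`, equal to `∫_{(0, x)} F dm` for `x > 0`; its increments
are the integrals over `[a, b)`. -/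
def lowPrimLeft (m : Measure ℝ) (F : ℝ → ℝ) (x : ℝ) : ℝ := lowPrim m F x - F x * m.real {x}

theorem isPrimIoc_lowPrim (hF : ∀ a b, IntegrableOn F (Set.Icc a b) m) :
    IsPrimIoc m F (lowPrim m F) := by
  intro a b hab
  have hi : ∀ u v, IntervalIntegrable F m u v := fun u v =>
    ⟨(hF u v).mono_set Set.Ioc_subset_Icc_self, (hF v u).mono_set Set.Ioc_subset_Icc_self⟩
  rw [lowPrim, lowPrim, intervalIntegral.integral_interval_sub_left (hi _ _) (hi _ _),
    intervalIntegral.integral_of_le hab]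

theorem isPrimIco_lowPrimLeft (hF : ∀ a b, IntegrableOn F (Set.Icc a b) m) :
    IsPrimIco m F (lowPrimLeft m F) := by
  intro a b hab
  rcases hab.eq_or_lt with rfl | hab
  · simp
  have h1 := isPrimIoc_lowPrim hF a b hab.le
  have hsub : IntegrableOn F (Set.Ioo a b) m := (hF a b).mono_set Set.Ioo_subset_Icc_self
  have hs : ∀ c, IntegrableOn F {c} m := fun c => by simpa using hF c c
  have h2 : ∫ t in Set.Ioc a b, F t ∂m = (∫ t in Set.Ioo a b, F t ∂m) + F b * m.real {b} := by
    rw [← Set.Ioo_union_right hab, setIntegral_union (by simp) (measurableSet_singleton b)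
      hsub (hs b), integral_singleton]
    simp [mul_comm]
  have h3 : ∫ t in Set.Ico a b, F t ∂m = (∫ t in Set.Ioo a b, F t ∂m) + F a * m.real {a} := by
    rw [← Set.Ioo_union_left hab, setIntegral_union (by simp) (measurableSet_singleton a)
      hsub (hs a), integral_singleton]
    simp [mul_comm]
  simp only [lowPrimLeft]
  linarith

theorem lowPrim_add_one (hm : m.map (fun x => x + 1) = m) (hF : ∀ x, F (x + 1) = F x)
    (hi : ∀ a b, IntegrableOn F (Set.Icc a b) m) (x : ℝ) :
    lowPrim m F (x + 1) = lowPrim m F x + ∫ t in Set.Ioc 0 1, F t ∂m := by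
  have hs : ∀ a b : ℝ, ∫ t in Set.Ioc (a + 1) (b + 1), F t ∂m = ∫ t in Set.Ioc a b, F t ∂m := by
    intro a b
    rw [setIntegral_shift hm hF]; simp
  have h1 := isPrimIoc_lowPrim hi 0 1 zero_le_one
  have h0 : lowPrim m F 0 = 0 := by simp [lowPrim]
  rcases le_total 0 x with hx | hx
  · have h2 := isPrimIoc_lowPrim hi (0 + 1) (x + 1) (by linarith)
    have h3 := isPrimIoc_lowPrim hi 0 x hx
    rw [hs] at h2
    rw [zero_add] at h2
    linarith
  · have h2 := isPrimIoc_lowPrim hi (x + 1) (0 + 1) (by linarith)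
    have h3 := isPrimIoc_lowPrim hi x 0 hx
    rw [hs] at h2
    rw [zero_add] at h2
    linarith

theorem lowPrimLeft_add_one (hm : m.map (fun x => x + 1) = m) (hF : ∀ x, F (x + 1) = F x)
    (hi : ∀ a b, IntegrableOn F (Set.Icc a b) m) (x : ℝ) :
    lowPrimLeft m F (x + 1) = lowPrimLeft m F x + ∫ t in Set.Ioc 0 1, F t ∂m := by
  have h1 : m.real {x + 1} = m.real {x} := by
    conv_lhs => rw [← hm]
    rw [Measure.real, Measure.map_apply (measurable_add_const 1) (measurableSet_singleton _)]
    congr 2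
    ext y; simp
  simp only [lowPrimLeft, lowPrim_add_one hm hF hi, h1, hF]
  ring

theorem lowPrim_of_nonneg {x : ℝ} (hx : 0 ≤ x) : lowPrim m F x = ∫ t in Set.Ioc 0 x, F t ∂m :=
  intervalIntegral.integral_of_le hx

theorem lowPrimLeft_of_pos (hi : ∀ a b, IntegrableOn F (Set.Icc a b) m) {x : ℝ} (hx : 0 < x) :
    lowPrimLeft m F x = ∫ t in Set.Ioo 0 x, F t ∂m := by
  have hsub : IntegrableOn F (Set.Ioo 0 x) m := (hi 0 x).mono_set Set.Ioo_subset_Icc_self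
  have hs : IntegrableOn F {x} m := by simpa using hi x x
  rw [lowPrimLeft, lowPrim_of_nonneg hx.le, ← Set.Ioo_union_right hx,
    setIntegral_union (by simp) (measurableSet_singleton x) hsub hs, integral_singleton]
  simp [mul_comm]

end Periodic

/-! ### The fundamental domain `(0, 1]` of the circle -/

/-- The representative of a point of the circle in `(0, 1]`. -/
def rep (x : Circ) : ℝ := (AddCircle.measurableEquivIoc (1 : ℝ) 0 x : ℝ)

theorem rep_mem (x : Circ) : rep x ∈ Set.Ioc (0 : ℝ) 1 := by
  have h : rep x ∈ Set.Ioc (0 : ℝ) (0 + 1) := (AddCircle.measurableEquivIoc (1 : ℝ) 0 x).2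
  rwa [zero_add] at h

theorem coe_rep (x : Circ) : ((rep x : ℝ) : Circ) = x :=
  (AddCircle.equivIoc (1 : ℝ) 0).symm_apply_apply x

theorem rep_coe {x : ℝ} (hx : x ∈ Set.Ioc (0 : ℝ) 1) : rep (x : Circ) = x := by
  have h := AddCircle.equivIoc_coe_eq (p := (1 : ℝ)) (a := 0) (x := x) (by rwa [zero_add])
  exact congrArg Subtype.val h

theorem measurable_rep : Measurable rep :=
  measurable_subtype_coe.comp (AddCircle.measurableEquivIoc (1 : ℝ) 0).measurable

theorem measurable_coe : Measurable (fun x : ℝ => (x : Circ)) :=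
  (AddCircle.continuous_mk' (1 : ℝ)).measurable

theorem coe_add_one (x : ℝ) : ((x + 1 : ℝ) : Circ) = x := AddCircle.coe_add_period 1 x

/-- A `1`-periodic function of a real number depends only on the representative in `(0, 1]`. -/
theorem apply_rep_coe {f : ℝ → ℝ} (hf : ∀ x, f (x + 1) = f x) (y : ℝ) :
    f (rep (y : Circ)) = f y := by
  have h : Function.Periodic f 1 := hf
  rw [← h.lift_coe (rep (y : Circ)), ← h.lift_coe y]
  exact congrArg h.lift (coe_rep (y : Circ))

/-! ### Regularity on the circle -/

theorem Caglad.measurable {f : Circ → ℝ} (hf : Caglad f) : Measurable f := by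
  have h := (measurable_of_leftCont fun x => (hf x).1).comp measurable_rep
  simpa only [Function.comp_def, coe_rep] using h

theorem Cadlag.measurable {f : Circ → ℝ} (hf : Cadlag f) : Measurable f := by
  have h := (measurable_of_rightCont fun x => (hf x).1).comp measurable_rep
  simpa only [Function.comp_def, coe_rep] using h

theorem Caglad.bounded {f : Circ → ℝ} (hf : Caglad f) : ∃ C, ∀ x, |f x| ≤ C := by
  obtain ⟨C, hC⟩ := exists_bound_of_oneSided_limits
    (fun x => ⟨_, (hf x).1.tendsto.mono_left (nhdsWithin_mono _ Set.Iio_subset_Iic_self)⟩)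
    (fun x => (hf x).2) (isCompact_Icc (a := (0 : ℝ)) (b := 1))
  exact ⟨C, fun x => by
    simpa only [coe_rep] using hC (rep x) (Set.Ioc_subset_Icc_self (rep_mem x))⟩

theorem Cadlag.bounded {f : Circ → ℝ} (hf : Cadlag f) : ∃ C, ∀ x, |f x| ≤ C := by
  obtain ⟨C, hC⟩ := exists_bound_of_oneSided_limits (fun x => (hf x).2)
    (fun x => ⟨_, (hf x).1.tendsto.mono_left (nhdsWithin_mono _ Set.Ioi_subset_Ici_self)⟩)
    (isCompact_Icc (a := (0 : ℝ)) (b := 1))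
  exact ⟨C, fun x => by
    simpa only [coe_rep] using hC (rep x) (Set.Ioc_subset_Icc_self (rep_mem x))⟩

theorem Caglad.memLp {f : Circ → ℝ} (hf : Caglad f) (μ : Measure Circ) [IsFiniteMeasure μ]
    (p : ENNReal) : MemLp f p μ := by
  obtain ⟨C, hC⟩ := hf.bounded
  exact MemLp.of_bound hf.measurable.aestronglyMeasurable C (Eventually.of_forall hC)

theorem Cadlag.memLp {f : Circ → ℝ} (hf : Cadlag f) (μ : Measure Circ) [IsFiniteMeasure μ]
    (p : ENNReal) : MemLp f p μ := by
  obtain ⟨C, hC⟩ := hf.bounded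
  exact MemLp.of_bound hf.measurable.aestronglyMeasurable C (Eventually.of_forall hC)

theorem Caglad.add_mul_const {f g : Circ → ℝ} (hf : Caglad f) (hg : Caglad g) (c d : ℝ) :
    Caglad fun x => f x + (c * g x + d) := fun x => by
  obtain ⟨l, hl⟩ := (hf x).2
  obtain ⟨k, hk⟩ := (hg x).2
  exact ⟨(hf x).1.add (((hg x).1.const_mul c).add continuousWithinAt_const),
    _, hl.add ((hk.const_mul c).add tendsto_const_nhds)⟩

theorem Cadlag.add_mul_const {f g : Circ → ℝ} (hf : Cadlag f) (hg : Cadlag g) (c d : ℝ) :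
    Cadlag fun x => f x + (c * g x + d) := fun x => by
  obtain ⟨l, hl⟩ := (hf x).2
  obtain ⟨k, hk⟩ := (hg x).2
  exact ⟨(hf x).1.add (((hg x).1.const_mul c).add continuousWithinAt_const),
    _, hl.add ((hk.const_mul c).add tendsto_const_nhds)⟩

theorem caglad_zero : Caglad fun _ => 0 := fun _ =>
  ⟨continuousWithinAt_const, 0, tendsto_const_nhds⟩

theorem cadlag_zero : Cadlag fun _ => 0 := fun _ =>
  ⟨continuousWithinAt_const, 0, tendsto_const_nhds⟩

theorem Caglad.const_mul {f : Circ → ℝ} (hf : Caglad f) (c : ℝ) : Caglad fun x => c * f x := by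
  simpa using caglad_zero.add_mul_const hf c 0

theorem Cadlag.const_mul {f : Circ → ℝ} (hf : Cadlag f) (c : ℝ) : Cadlag fun x => c * f x := by
  simpa using cadlag_zero.add_mul_const hf c 0

theorem Caglad.sub {f g : Circ → ℝ} (hf : Caglad f) (hg : Caglad g) :
    Caglad fun x => f x - g x := by
  simpa [sub_eq_add_neg] using hf.add_mul_const hg (-1) 0

theorem Cadlag.sub {f g : Circ → ℝ} (hf : Cadlag f) (hg : Cadlag g) :
    Cadlag fun x => f x - g x := by
  simpa [sub_eq_add_neg] using hf.add_mul_const hg (-1) 0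

theorem Caglad.add_const {f : Circ → ℝ} (hf : Caglad f) (c : ℝ) : Caglad fun x => f x + c := by
  simpa using hf.add_mul_const caglad_zero 0 c

theorem Cadlag.add_const {f : Circ → ℝ} (hf : Cadlag f) (c : ℝ) : Cadlag fun x => f x + c := by
  simpa using hf.add_mul_const cadlag_zero 0 c

/-! ### One-sided derivatives on the circle -/

section Deriv

variable {φ : ℝ → ℝ} {f g F G : Circ → ℝ}

theorem HasLeftDeriv.unique (h : HasLeftDeriv φ f F) (h' : HasLeftDeriv φ f G) : F = G := by
  funext x
  rw [← coe_rep x]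
  exact tendsto_nhds_unique (h _) (h' _)

theorem HasRightDeriv.unique (h : HasRightDeriv φ f F) (h' : HasRightDeriv φ f G) : F = G := by
  funext x
  rw [← coe_rep x]
  exact tendsto_nhds_unique (h _) (h' _)

theorem LeftDifferentiable.hasLeftDeriv (h : LeftDifferentiable φ f) :
    HasLeftDeriv φ f (leftDeriv φ f) := by
  rw [leftDeriv, dif_pos h]; exact Classical.choose_spec h

theorem RightDifferentiable.hasRightDeriv (h : RightDifferentiable φ f) :
    HasRightDeriv φ f (rightDeriv φ f) := by
  rw [rightDeriv, dif_pos h]; exact Classical.choose_spec h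

theorem HasLeftDeriv.leftDeriv_eq (h : HasLeftDeriv φ f F) : leftDeriv φ f = F :=
  (LeftDifferentiable.hasLeftDeriv ⟨F, h⟩).unique h

theorem HasRightDeriv.rightDeriv_eq (h : HasRightDeriv φ f F) : rightDeriv φ f = F :=
  (RightDifferentiable.hasRightDeriv ⟨F, h⟩).unique h

theorem HasLeftDeriv.add_const (h : HasLeftDeriv φ f F) (c : ℝ) :
    HasLeftDeriv φ (fun x => f x + c) F := fun x => by
  simpa using h x

theorem HasRightDeriv.add_const (h : HasRightDeriv φ f F) (c : ℝ) :
    HasRightDeriv φ (fun x => f x + c) F := fun x => by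
  simpa using h x

theorem HasLeftDeriv.sub (h : HasLeftDeriv φ f F) (h' : HasLeftDeriv φ g G) :
    HasLeftDeriv φ (fun x => f x - g x) fun x => F x - G x := fun x =>
  ((h x).sub (h' x)).congr fun y => by ring

theorem HasRightDeriv.sub (h : HasRightDeriv φ f F) (h' : HasRightDeriv φ g G) :
    HasRightDeriv φ (fun x => f x - g x) fun x => F x - G x := fun x =>
  ((h x).sub (h' x)).congr fun y => by ring

theorem HasLeftDeriv.const_mul (h : HasLeftDeriv φ f F) (c : ℝ) :
    HasLeftDeriv φ (fun x => c * f x) fun x => c * F x := fun x =>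
  ((h x).const_mul c).congr fun y => by ring

theorem HasRightDeriv.const_mul (h : HasRightDeriv φ f F) (c : ℝ) :
    HasRightDeriv φ (fun x => c * f x) fun x => c * F x := fun x =>
  ((h x).const_mul c).congr fun y => by ring

theorem hasRightDeriv_zero : HasRightDeriv φ (fun _ => 0) fun _ => 0 := fun x => by
  simp

end Deriv

/-! ### Measures on the circle -/

/-- The measure on the circle induced by a measure on the line. -/
def circMeasure (m : Measure ℝ) : Measure Circ :=
  (m.restrict (Set.Ioc 0 1)).map (fun x : ℝ => (x : Circ))

section CircMeasure

variable {m : Measure ℝ} {F : Circ → ℝ}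

instance [IsLocallyFiniteMeasure m] : IsFiniteMeasure (m.restrict (Set.Ioc (0 : ℝ) 1)) :=
  ⟨by
    rw [Measure.restrict_apply_univ]
    exact (measure_mono Set.Ioc_subset_Icc_self).trans_lt isCompact_Icc.measure_lt_top⟩

instance [IsLocallyFiniteMeasure m] : IsFiniteMeasure (circMeasure m) := by
  unfold circMeasure; infer_instance

theorem integrableOn_of_integrable_circ (hF : Integrable F (circMeasure m)) :
    IntegrableOn (fun x : ℝ => F x) (Set.Ioc 0 1) m :=
  hF.comp_measurable measurable_coe

theorem integral_circ (hF : AEStronglyMeasurable F (circMeasure m)) :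
    ∫ x, F x ∂circMeasure m = ∫ x in Set.Ioc (0 : ℝ) 1, F (x : Circ) ∂m :=
  integral_map measurable_coe.aemeasurable hF

/-- The circle measure sees exactly what happens on the fundamental domain `(0, 1]`. -/
theorem ae_circ_iff {p : Circ → Prop} (hp : MeasurableSet {x | p x}) :
    (∀ᵐ x ∂circMeasure m, p x) ↔ ∀ᵐ x : ℝ ∂m.restrict (Set.Ioc 0 1), p (x : Circ) :=
  ae_map_iff measurable_coe.aemeasurable hp

theorem integrableOn_Icc_of_circ [IsLocallyFiniteMeasure m] (hm : m.map (fun x => x + 1) = m)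
    (hF : Integrable F (circMeasure m)) (a b : ℝ) :
    IntegrableOn (fun x : ℝ => F x) (Set.Icc a b) m :=
  integrableOn_Icc_of_periodic hm (fun x => by rw [coe_add_one])
    (integrableOn_of_integrable_circ hF) a b

end CircMeasure

/-- `f` minus its mean with respect to the finite measure `μ`. -/
def center {α : Type*} [MeasurableSpace α] (μ : Measure α) (f : α → ℝ) : α → ℝ :=
  fun x => f x - (∫ y, f y ∂μ) / μ.real Set.univ

section Center

variable {α : Type*} [MeasurableSpace α] {μ : Measure α} {f g : α → ℝ}

theorem center_eq_add_const (μ : Measure α) (f : α → ℝ) :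
    center μ f = fun x => f x + -((∫ y, f y ∂μ) / μ.real Set.univ) :=
  funext fun _ => sub_eq_add_neg _ _

theorem center_congr (h : f =ᵐ[μ] g) : center μ f =ᵐ[μ] center μ g := by
  filter_upwards [h] with x hx
  simp only [center, hx, integral_congr_ae h]

theorem center_of_integral_eq_zero (h : ∫ x, f x ∂μ = 0) : center μ f = f := by
  funext x; simp [center, h]

theorem integrable_center [IsFiniteMeasure μ] (hf : Integrable f μ) : Integrable (center μ f) μ :=
  hf.sub (integrable_const _)

theorem integral_center [IsFiniteMeasure μ] [NeZero μ] (hf : Integrable f μ) :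
    ∫ x, center μ f x ∂μ = 0 := by
  have h : μ.real Set.univ ≠ 0 := by simp [measureReal_eq_zero_iff, NeZero.ne μ]
  unfold center
  rw [integral_sub hf (integrable_const _), integral_const, smul_eq_mul, mul_div_cancel₀ _ h,
    sub_self]

theorem center_center [IsFiniteMeasure μ] [NeZero μ] (hf : Integrable f μ) :
    center μ (center μ f) = center μ f :=
  center_of_integral_eq_zero (integral_center hf)

theorem center_add_const [IsFiniteMeasure μ] [NeZero μ] (hf : Integrable f μ) (c : ℝ) :
    center μ (fun x => f x + c) = center μ f := by
  have h : μ.real Set.univ ≠ 0 := by simp [measureReal_eq_zero_iff, NeZero.ne μ]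
  funext x
  simp only [center]
  rw [integral_add hf (integrable_const _), integral_const, smul_eq_mul, add_div,
    mul_div_cancel_left₀ _ h]
  ring

theorem center_add (hf : Integrable f μ) (hg : Integrable g μ) :
    center μ (fun x => f x + g x) = fun x => center μ f x + center μ g x := by
  funext x
  simp only [center]
  rw [integral_add hf hg]; ring

theorem center_const_mul (c : ℝ) :
    center μ (fun x => c * f x) = fun x => c * center μ f x := by
  funext x
  simp only [center]
  rw [integral_const_mul]; ring

theorem abs_center_le [IsFiniteMeasure μ] [NeZero μ] {C : ℝ} (hC : ∀ x, |f x| ≤ C) (x : α) :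
    |center μ f x| ≤ 2 * C := by
  have h : 0 < μ.real Set.univ :=
    lt_of_le_of_ne measureReal_nonneg (Ne.symm (by simp [measureReal_eq_zero_iff, NeZero.ne μ]))
  have h1 : |∫ y, f y ∂μ| ≤ C * μ.real Set.univ :=
    norm_integral_le_of_norm_le_const (μ := μ) (f := f) (Eventually.of_forall hC)
  have h2 : |(∫ y, f y ∂μ) / μ.real Set.univ| ≤ C := by
    rw [abs_div, abs_of_pos h, div_le_iff₀ h]; exact h1
  have := abs_sub (f x) ((∫ y, f y ∂μ) / μ.real Set.univ)
  unfold center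
  linarith [hC x]

theorem integral_abs_center_le [IsFiniteMeasure μ] [NeZero μ] (hf : Integrable f μ) :
    ∫ x, |center μ f x| ∂μ ≤ 2 * ∫ x, |f x| ∂μ := by
  have h : 0 < μ.real Set.univ :=
    lt_of_le_of_ne measureReal_nonneg (Ne.symm (by simp [measureReal_eq_zero_iff, NeZero.ne μ]))
  have h1 : ∫ x, |center μ f x| ∂μ ≤
      ∫ x, (|f x| + |(∫ y, f y ∂μ) / μ.real Set.univ|) ∂μ :=
    integral_mono (integrable_center hf).abs (hf.abs.add (integrable_const _))
      fun x => abs_sub _ _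
  rw [integral_add hf.abs (integrable_const _), integral_const, smul_eq_mul, abs_div,
    abs_of_pos h, mul_div_cancel₀ _ h.ne'] at h1
  linarith [abs_integral_le_integral_abs (f := f) (μ := μ)]

/-- Subtracting the mean is a symmetric operation. -/
theorem integral_center_mul [IsFiniteMeasure μ] (hf : Integrable f μ) (hg : Integrable g μ)
    (hfg : Integrable (fun x => f x * g x) μ) :
    ∫ x, center μ f x * g x ∂μ = ∫ x, f x * center μ g x ∂μ := by
  simp only [center, sub_mul, mul_sub]
  rw [integral_sub hfg (hg.const_mul _), integral_sub hfg (hf.mul_const _), integral_const_mul,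
    integral_mul_const]
  ring

end Center

/-! ### The Lebesgue–Stieltjes measures of `W` and `V` -/

namespace Weights

variable (P : Weights)

instance : IsLocallyFiniteMeasure P.dW := by unfold Weights.dW; infer_instance
instance : IsLocallyFiniteMeasure P.dV := by unfold Weights.dV; infer_instance

theorem dW_Ioc (a b : ℝ) : P.dW (Set.Ioc a b) = ENNReal.ofReal (P.W b - P.W a) := by
  rw [dW, StieltjesFunction.measure_Ioc]
  simp only [Monotone.stieltjesFunction_eq]
  have h : ∀ x, Function.rightLim P.W x = P.W x := fun x =>
    (P.strictMono_W.monotone.continuousWithinAt_Ioi_iff_rightLim_eq).1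
      (continuousWithinAt_Ioi_iff_Ici.2 (P.rightCont_W x))
  rw [h, h]

theorem dV_Ico (a b : ℝ) : P.dV (Set.Ico a b) = ENNReal.ofReal (P.V b - P.V a) := by
  rw [dV, StieltjesFunction.measure_Ico]
  have h : ∀ x, Function.leftLim P.strictMono_V.monotone.stieltjesFunction x = P.V x := by
    intro x
    have h1 : Tendsto P.strictMono_V.monotone.stieltjesFunction (𝓝[<] x) (𝓝 (P.V x)) := by
      -- for `y < x`, `V y ≤ V (y+) ≤ V x`
      refine tendsto_of_tendsto_of_tendsto_of_le_of_le'
        ((P.leftCont_V x).tendsto.mono_left (nhdsWithin_mono _ Set.Iio_subset_Iic_self))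
        tendsto_const_nhds ?_ ?_
      · exact Eventually.of_forall fun y => by
          rw [Monotone.stieltjesFunction_eq]
          exact P.strictMono_V.monotone.le_rightLim le_rfl
      · filter_upwards [self_mem_nhdsWithin] with y hy
        rw [Monotone.stieltjesFunction_eq]
        exact P.strictMono_V.monotone.rightLim_le hy
    exact leftLim_eq_of_tendsto h1
  rw [h, h]

theorem dW_real_Ioc (a b : ℝ) (hab : a ≤ b) : P.dW.real (Set.Ioc a b) = P.W b - P.W a := by
  rw [Measure.real, dW_Ioc, ENNReal.toReal_ofReal (sub_nonneg.2 (P.strictMono_W.monotone hab))]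

theorem dV_real_Ico (a b : ℝ) (hab : a ≤ b) : P.dV.real (Set.Ico a b) = P.V b - P.V a := by
  rw [Measure.real, dV_Ico, ENNReal.toReal_ofReal (sub_nonneg.2 (P.strictMono_V.monotone hab))]

theorem dW_shift : P.dW.map (fun x => x + 1) = P.dW := by
  refine (Measure.ext_of_Ioc _ _ fun a b _ => ?_).symm
  rw [Measure.map_apply (measurable_add_const 1) measurableSet_Ioc, Set.preimage_add_const_Ioc,
    dW_Ioc, dW_Ioc]
  have h1 := P.periodic_W (a - 1)
  have h2 := P.periodic_W (b - 1)
  rw [sub_add_cancel] at h1 h2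
  congr 1; linarith

theorem dV_shift : P.dV.map (fun x => x + 1) = P.dV := by
  refine (Measure.ext_of_Ico _ _ fun a b _ => ?_).symm
  rw [Measure.map_apply (measurable_add_const 1) measurableSet_Ico, Set.preimage_add_const_Ico,
    dV_Ico, dV_Ico]
  have h1 := P.periodic_V (a - 1)
  have h2 := P.periodic_V (b - 1)
  rw [sub_add_cancel] at h1 h2
  congr 1; linarith

theorem dW_Ioo_pos {a b : ℝ} (hab : a < b) : 0 < P.dW (Set.Ioo a b) := by
  obtain ⟨c, hac, hcb⟩ := exists_between hab
  refine lt_of_lt_of_le ?_ (measure_mono (show Set.Ioc a c ⊆ Set.Ioo a b from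
    fun x hx => ⟨hx.1, hx.2.trans_lt hcb⟩))
  rw [dW_Ioc, ENNReal.ofReal_pos, sub_pos]
  exact P.strictMono_W hac

theorem dV_Ioo_pos {a b : ℝ} (hab : a < b) : 0 < P.dV (Set.Ioo a b) := by
  obtain ⟨c, hac, hcb⟩ := exists_between hab
  refine lt_of_lt_of_le ?_ (measure_mono (show Set.Ico c b ⊆ Set.Ioo a b from
    fun x hx => ⟨hac.trans_le hx.1, hx.2⟩))
  rw [dV_Ico, ENNReal.ofReal_pos, sub_pos]
  exact P.strictMono_V hcb

instance : IsFiniteMeasure P.μW := inferInstanceAs (IsFiniteMeasure (circMeasure P.dW))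
instance : IsFiniteMeasure P.μV := inferInstanceAs (IsFiniteMeasure (circMeasure P.dV))

instance : NeZero P.μW := ⟨fun h => by
  have h1 : P.μW Set.univ = 0 := by simp [h]
  rw [μW, Measure.map_apply measurable_coe MeasurableSet.univ, Set.preimage_univ,
    Measure.restrict_apply_univ] at h1
  exact ((P.dW_Ioo_pos zero_lt_one).trans_le (measure_mono Set.Ioo_subset_Ioc_self)).ne' h1⟩

instance : NeZero P.μV := ⟨fun h => by
  have h1 : P.μV Set.univ = 0 := by simp [h]
  rw [μV, Measure.map_apply measurable_coe MeasurableSet.univ, Set.preimage_univ,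
    Measure.restrict_apply_univ] at h1
  exact ((P.dV_Ioo_pos zero_lt_one).trans_le (measure_mono Set.Ioo_subset_Ioc_self)).ne' h1⟩

end Weights

/-! ### Functions determined by their integrals over half-lines -/

section HalfLines

variable {ν : Measure ℝ} {H : ℝ → ℝ}

/-- If `∫_s H = 0` then the positive and negative parts of `H dν` give the same mass to `s`. -/
theorem withDensity_ofReal_apply_eq {s : Set ℝ} (hH : Integrable H ν) (hs : MeasurableSet s)
    (h : ∫ t in s, H t ∂ν = 0) :
    ν.withDensity (fun t => ENNReal.ofReal (H t)) s =
      ν.withDensity (fun t => ENNReal.ofReal (-H t)) s := by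
  rw [withDensity_apply _ hs, withDensity_apply _ hs]
  rw [integral_eq_lintegral_pos_part_sub_lintegral_neg_part hH.integrableOn, sub_eq_zero] at h
  have h1 : ∫⁻ t in s, ENNReal.ofReal (H t) ∂ν ≠ ⊤ :=
    (Integrable.lintegral_lt_top (μ := ν.restrict s) hH.integrableOn).ne
  have h2 : ∫⁻ t in s, ENNReal.ofReal (-H t) ∂ν ≠ ⊤ :=
    (Integrable.lintegral_lt_top (μ := ν.restrict s) hH.neg.integrableOn).ne
  exact (ENNReal.toReal_eq_toReal_iff' h1 h2).1 h

theorem ae_eq_zero_of_withDensity_eq [IsFiniteMeasure ν] (hH : Integrable H ν)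
    (h : ν.withDensity (fun t => ENNReal.ofReal (H t)) =
      ν.withDensity (fun t => ENNReal.ofReal (-H t))) : ∀ᵐ t ∂ν, H t = 0 := by
  have h2 := (withDensity_eq_iff hH.aestronglyMeasurable.aemeasurable.ennreal_ofReal
    hH.neg.aestronglyMeasurable.aemeasurable.ennreal_ofReal (Integrable.lintegral_lt_top hH).ne).1 h
  filter_upwards [h2] with t ht
  rw [Pi.neg_apply] at ht
  rcases le_total 0 (H t) with h0 | h0
  · rw [ENNReal.ofReal_of_nonpos (neg_nonpos.2 h0), ENNReal.ofReal_eq_zero] at ht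
    exact le_antisymm ht h0
  · rw [ENNReal.ofReal_of_nonpos h0, eq_comm, ENNReal.ofReal_eq_zero, neg_nonpos] at ht
    exact le_antisymm h0 ht

theorem ae_eq_zero_of_integral_Iic [IsFiniteMeasure ν] (hH : Integrable H ν)
    (h : ∀ x, ∫ t in Set.Iic x, H t ∂ν = 0) : ∀ᵐ t ∂ν, H t = 0 := by
  have : IsFiniteMeasure (ν.withDensity (fun t => ENNReal.ofReal (H t))) :=
    isFiniteMeasure_withDensity (Integrable.lintegral_lt_top hH).ne
  exact ae_eq_zero_of_withDensity_eq hH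
    (Measure.ext_of_Iic _ _ fun x => withDensity_ofReal_apply_eq hH measurableSet_Iic (h x))

theorem ae_eq_zero_of_integral_Ici [IsFiniteMeasure ν] (hH : Integrable H ν)
    (h : ∀ x, ∫ t in Set.Ici x, H t ∂ν = 0) : ∀ᵐ t ∂ν, H t = 0 := by
  have : IsFiniteMeasure (ν.withDensity (fun t => ENNReal.ofReal (H t))) :=
    isFiniteMeasure_withDensity (Integrable.lintegral_lt_top hH).ne
  exact ae_eq_zero_of_withDensity_eq hH
    (Measure.ext_of_Ici _ _ fun x => withDensity_ofReal_apply_eq hH measurableSet_Ici (h x))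

end HalfLines

section FullSupport

variable {m : Measure ℝ} {p : ℝ → ℝ} {c : ℝ}

/-- A right-continuous function that is a.e. constant on `(0, 1]`, for a measure of full support, is
constant on `[0, 1)`. -/
theorem eq_of_ae_eq_of_rightCont (hm : ∀ a b, a < b → 0 < m (Set.Ioo a b))
    (hp : ∀ x, ContinuousWithinAt p (Set.Ici x) x)
    (h : ∀ᵐ y ∂m.restrict (Set.Ioc 0 1), p y = c) {x : ℝ} (hx : x ∈ Set.Ico (0 : ℝ) 1) :
    p x = c := by
  by_contra hne
  have h1 := (hp x).tendsto.eventually_ne hne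
  obtain ⟨u, hu, hsub⟩ := mem_nhdsGE_iff_exists_Ico_subset.1 h1
  have hu : x < u := hu
  rw [ae_restrict_iff' measurableSet_Ioc] at h
  refine (hm x (min u 1) (lt_min hu hx.2)).ne' (measure_mono_null (fun y hy => ?_) h)
  simp only [Set.mem_compl_iff, Set.mem_ofPred_eq, not_forall]
  exact ⟨⟨hx.1.trans_lt hy.1, (hy.2.trans_le (min_le_right _ _)).le⟩,
    hsub ⟨hy.1.le, hy.2.trans_le (min_le_left _ _)⟩⟩

theorem eq_of_ae_eq_of_leftCont (hm : ∀ a b, a < b → 0 < m (Set.Ioo a b))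
    (hp : ∀ x, ContinuousWithinAt p (Set.Iic x) x)
    (h : ∀ᵐ y ∂m.restrict (Set.Ioc 0 1), p y = c) {x : ℝ} (hx : x ∈ Set.Ioc (0 : ℝ) 1) :
    p x = c := by
  by_contra hne
  have h1 := (hp x).tendsto.eventually_ne hne
  obtain ⟨u, hu, hsub⟩ := mem_nhdsLE_iff_exists_Ioc_subset.1 h1
  have hu : u < x := hu
  rw [ae_restrict_iff' measurableSet_Ioc] at h
  refine (hm (max u 0) x (max_lt hu hx.1)).ne' (measure_mono_null (fun y hy => ?_) h)
  simp only [Set.mem_compl_iff, Set.mem_ofPred_eq, not_forall]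
  exact ⟨⟨(le_max_right _ _).trans_lt hy.1, hy.2.le.trans hx.2⟩,
    hsub ⟨(le_max_left _ _).trans_lt hy.1, hy.2.le⟩⟩

end FullSupport

namespace Weights

variable (P : Weights)

/-! ### Primitives on the circle -/

/-- The primitive `x ↦ ∫_{(0, x]} F dW`, computed on the representative in `(0, 1]`. It is càdlàg
on the circle only if `F` has mean zero; otherwise it jumps at `0`. -/
def primW (F : Circ → ℝ) (x : Circ) : ℝ := ∫ t in Set.Ioc 0 (rep x), F (t : Circ) ∂P.dW

/-- The primitive `x ↦ ∫_{(0, x)} G dV`, computed on the representative in `(0, 1]`. The left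
endpoint is left out: including it would only add a constant, and this form matches the
fundamental domain `(0, 1]`. -/
def primV (G : Circ → ℝ) (x : Circ) : ℝ := ∫ t in Set.Ioo 0 (rep x), G (t : Circ) ∂P.dV

variable {P} {F F' G G' u g : Circ → ℝ}

theorem integrableOn_dW (hF : Integrable F P.μW) (a b : ℝ) :
    IntegrableOn (fun x : ℝ => F x) (Set.Icc a b) P.dW :=
  integrableOn_Icc_of_circ P.dW_shift hF a b

theorem integrableOn_dV (hG : Integrable G P.μV) (a b : ℝ) :
    IntegrableOn (fun x : ℝ => G x) (Set.Icc a b) P.dV :=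
  integrableOn_Icc_of_circ P.dV_shift hG a b

theorem integral_μW (hF : Integrable F P.μW) :
    ∫ x, F x ∂P.μW = ∫ x in Set.Ioc (0 : ℝ) 1, F (x : Circ) ∂P.dW :=
  integral_circ (m := P.dW) hF.aestronglyMeasurable

theorem integral_μV (hG : Integrable G P.μV) :
    ∫ x, G x ∂P.μV = ∫ x in Set.Ioc (0 : ℝ) 1, G (x : Circ) ∂P.dV :=
  integral_circ (m := P.dV) hG.aestronglyMeasurable

/-- The mean of `F` vanishes, so the primitive on the line is periodic and agrees with the one on
the circle at every real point, not only on `(0, 1]`. -/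
theorem primW_coe (hF : Integrable F P.μW) (h0 : ∫ x, F x ∂P.μW = 0) (y : ℝ) :
    P.primW F y = lowPrim P.dW (fun x : ℝ => F x) y := by
  rw [primW, ← lowPrim_of_nonneg (rep_mem _).1.le]
  refine apply_rep_coe (f := lowPrim P.dW (fun x : ℝ => F x)) (fun x => ?_) y
  rw [lowPrim_add_one P.dW_shift (fun x => by rw [coe_add_one]) (integrableOn_dW hF),
    ← integral_μW hF, h0, add_zero]

theorem primV_coe (hG : Integrable G P.μV) (h0 : ∫ x, G x ∂P.μV = 0) (y : ℝ) :
    P.primV G y = lowPrimLeft P.dV (fun x : ℝ => G x) y := by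
  rw [primV, ← lowPrimLeft_of_pos (integrableOn_dV hG) (rep_mem _).1]
  refine apply_rep_coe (f := lowPrimLeft P.dV (fun x : ℝ => G x)) (fun x => ?_) y
  rw [lowPrimLeft_add_one P.dV_shift (fun x => by rw [coe_add_one]) (integrableOn_dV hG),
    ← integral_μV hG, h0, add_zero]

theorem cadlag_primW (hF : Integrable F P.μW) (h0 : ∫ x, F x ∂P.μW = 0) : Cadlag (P.primW F) := by
  intro x
  simp only [primW_coe hF h0]
  exact ⟨(isPrimIoc_lowPrim (integrableOn_dW hF)).rightCont (integrableOn_dW hF) x,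
    (isPrimIoc_lowPrim (integrableOn_dW hF)).leftLim (integrableOn_dW hF) x⟩

theorem caglad_primV (hG : Integrable G P.μV) (h0 : ∫ x, G x ∂P.μV = 0) : Caglad (P.primV G) := by
  intro x
  simp only [primV_coe hG h0]
  exact ⟨(isPrimIco_lowPrimLeft (integrableOn_dV hG)).leftCont (integrableOn_dV hG) x,
    (isPrimIco_lowPrimLeft (integrableOn_dV hG)).rightLim (integrableOn_dV hG) x⟩

theorem hasLeftDeriv_primW (hF : Caglad F) (h0 : ∫ x, F x ∂P.μW = 0) :
    HasLeftDeriv P.W (P.primW F) F := by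
  have hi := (hF.memLp P.μW 1).integrable le_rfl
  intro x
  simp only [primW_coe hi h0]
  exact (isPrimIoc_lowPrim (integrableOn_dW hi)).tendsto_slope (integrableOn_dW hi)
    P.strictMono_W P.dW_real_Ioc (hF x).1

theorem hasRightDeriv_primV (hG : Cadlag G) (h0 : ∫ x, G x ∂P.μV = 0) :
    HasRightDeriv P.V (P.primV G) G := by
  have hi := (hG.memLp P.μV 1).integrable le_rfl
  intro x
  simp only [primV_coe hi h0]
  exact (isPrimIco_lowPrimLeft (integrableOn_dV hi)).tendsto_slope (integrableOn_dV hi)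
    P.strictMono_V P.dV_real_Ico (hG x).1

/-- The fundamental theorem of calculus for `D_W⁻`. -/
theorem eq_primW_add_const (hu : Cadlag u) (hF : Caglad F) (h : HasLeftDeriv P.W u F) :
    ∫ x, F x ∂P.μW = 0 ∧ ∃ c, u = fun x => P.primW F x + c := by
  have hi := (hF.memLp P.μW 1).integrable le_rfl
  set p := lowPrim P.dW (fun x : ℝ => F x) with hp
  have hprim := isPrimIoc_lowPrim (integrableOn_dW hi)
  have key := eq_of_leftSlope_tendsto_zero (h := fun y : ℝ => u y - p y) P.strictMono_W
    P.rightCont_W (fun x => (hu x).1.sub (hprim.rightCont (integrableOn_dW hi) x)) fun x => by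
      have h1 := (h x).sub (hprim.tendsto_slope (integrableOn_dW hi) P.strictMono_W
        P.dW_real_Ioc (hF x).1)
      rw [sub_self] at h1
      exact h1.congr fun y => by ring
  have h0 : ∫ x, F x ∂P.μW = 0 := by
    have h1 := key 0 (0 + 1)
    have h2 := lowPrim_add_one P.dW_shift (F := fun x : ℝ => F x)
      (fun x => by rw [coe_add_one]) (integrableOn_dW hi) 0
    rw [← integral_μW hi, ← hp] at h2
    simp only [coe_add_one] at h1
    linarith
  refine ⟨h0, u (0 : ℝ) - p 0, funext fun x => ?_⟩
  rw [← coe_rep x, primW_coe hi h0, ← key (rep x) 0]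
  ring

/-- The fundamental theorem of calculus for `D_V⁺`. -/
theorem eq_primV_add_const (hg : Caglad g) (hG : Cadlag G) (h : HasRightDeriv P.V g G) :
    ∫ x, G x ∂P.μV = 0 ∧ ∃ c, g = fun x => P.primV G x + c := by
  have hi := (hG.memLp P.μV 1).integrable le_rfl
  set p := lowPrimLeft P.dV (fun x : ℝ => G x) with hp
  have hprim := isPrimIco_lowPrimLeft (integrableOn_dV hi)
  have key := eq_of_rightSlope_tendsto_zero (h := fun y : ℝ => g y - p y) P.strictMono_V
    P.leftCont_V (fun x => (hg x).1.sub (hprim.leftCont (integrableOn_dV hi) x)) fun x => by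
      have h1 := (h x).sub (hprim.tendsto_slope (integrableOn_dV hi) P.strictMono_V
        P.dV_real_Ico (hG x).1)
      rw [sub_self] at h1
      exact h1.congr fun y => by ring
  have h0 : ∫ x, G x ∂P.μV = 0 := by
    have h1 := key 0 (0 + 1)
    have h2 := lowPrimLeft_add_one P.dV_shift (F := fun x : ℝ => G x)
      (fun x => by rw [coe_add_one]) (integrableOn_dV hi) 0
    rw [← integral_μV hi, ← hp] at h2
    simp only [coe_add_one] at h1
    linarith
  refine ⟨h0, g (0 : ℝ) - p 0, funext fun x => ?_⟩
  rw [← coe_rep x, primV_coe hi h0, ← key (rep x) 0]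
  ring

theorem primW_congr (h : F =ᵐ[P.μW] F') : P.primW F = P.primW F' := by
  have h1 : ∀ᵐ t : ℝ ∂P.dW.restrict (Set.Ioc 0 1), F (t : Circ) = F' (t : Circ) :=
    ae_of_ae_map measurable_coe.aemeasurable h
  funext x
  exact integral_congr_ae
    (ae_restrict_of_ae_restrict_of_subset (Set.Ioc_subset_Ioc_right (rep_mem x).2) h1)

theorem primV_congr (h : G =ᵐ[P.μV] G') : P.primV G = P.primV G' := by
  have h1 : ∀ᵐ t : ℝ ∂P.dV.restrict (Set.Ioc 0 1), G (t : Circ) = G' (t : Circ) :=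
    ae_of_ae_map measurable_coe.aemeasurable h
  funext x
  exact integral_congr_ae (ae_restrict_of_ae_restrict_of_subset
    (Set.Ioo_subset_Ioc_self.trans (Set.Ioc_subset_Ioc_right (rep_mem x).2)) h1)

theorem primW_add (hF : Integrable F P.μW) (hF' : Integrable F' P.μW) (x : Circ) :
    P.primW (fun x => F x + F' x) x = P.primW F x + P.primW F' x :=
  integral_add ((integrableOn_dW hF _ _).mono_set Set.Ioc_subset_Icc_self)
    ((integrableOn_dW hF' _ _).mono_set Set.Ioc_subset_Icc_self)

theorem abs_primW_le (hF : Integrable F P.μW) (x : Circ) :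
    |P.primW F x| ≤ ∫ y, |F y| ∂P.μW := by
  rw [integral_μW hF.abs]
  refine (abs_integral_le_integral_abs).trans (setIntegral_mono_set ?_ ?_ ?_)
  · exact ((integrableOn_dW hF 0 1).mono_set Set.Ioc_subset_Icc_self).abs
  · exact Eventually.of_forall fun t => abs_nonneg _
  · exact (Set.Ioc_subset_Ioc_right (rep_mem x).2).eventuallyLE

/-! ### Integration by parts -/

/-- Integration by parts for the two primitives: the regions `{t ≤ x}` and `{x < t}` fill the
whole square `(0, 1]²`. -/
theorem integral_primW_mul_add (hF : Integrable F P.μW) (hG : Integrable G P.μV)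
    (hF0 : ∫ x, F x ∂P.μW = 0) (hG0 : ∫ x, G x ∂P.μV = 0) :
    ∫ x, P.primW F x * G x ∂P.μV + ∫ x, F x * P.primV G x ∂P.μW = 0 := by
  set w := P.dW.restrict (Set.Ioc (0 : ℝ) 1) with hw
  set v := P.dV.restrict (Set.Ioc (0 : ℝ) 1) with hv
  have hFw : Integrable (fun t : ℝ => F t) w := integrableOn_of_integrable_circ hF
  have hGv : Integrable (fun x : ℝ => G x) v := integrableOn_of_integrable_circ hG
  have hH : Integrable (fun z : ℝ × ℝ => F z.1 * G z.2) (w.prod v) := hFw.mul_prod hGv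
  set T : Set (ℝ × ℝ) := {z | z.1 ≤ z.2} with hT
  have hTm : MeasurableSet T := measurableSet_le measurable_fst measurable_snd
  have hc1 := (cadlag_primW hF hF0).measurable
  have hc2 := (caglad_primV hG hG0).measurable
  have e1 : ∫ x, P.primW F x * G x ∂P.μV =
      ∫ z, T.indicator (fun z : ℝ × ℝ => F z.1 * G z.2) z ∂w.prod v := by
    rw [integral_prod_symm _ (hH.indicator hTm)]
    have : ∫ x, P.primW F x * G x ∂P.μV = ∫ x : ℝ, P.primW F (x : Circ) * G (x : Circ) ∂v :=
      integral_circ (m := P.dV) (hc1.aestronglyMeasurable.mul hG.aestronglyMeasurable)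
    rw [this]
    refine integral_congr_ae ?_
    filter_upwards [ae_restrict_mem measurableSet_Ioc] with x hx
    have h2 : (fun t : ℝ => T.indicator (fun z : ℝ × ℝ => F z.1 * G z.2) (t, x)) =
        fun t => (Set.Iic x).indicator (fun t : ℝ => F t * G x) t := by
      funext t
      simp only [Set.indicator_apply, hT, Set.mem_ofPred_eq, Set.mem_Iic]
    rw [h2, integral_indicator measurableSet_Iic, hw, Measure.restrict_restrict measurableSet_Iic,
      integral_mul_const, primW, rep_coe hx]
    congr 3
    ext t
    simp only [Set.mem_Ioc, Set.mem_inter_iff, Set.mem_Iic]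
    exact ⟨fun h => ⟨h.2, h.1, h.2.trans hx.2⟩, fun h => ⟨h.2.1, h.1⟩⟩
  have e2 : ∫ x, F x * P.primV G x ∂P.μW =
      ∫ z, Tᶜ.indicator (fun z : ℝ × ℝ => F z.1 * G z.2) z ∂w.prod v := by
    rw [integral_prod _ (hH.indicator hTm.compl)]
    have : ∫ x, F x * P.primV G x ∂P.μW = ∫ x : ℝ, F (x : Circ) * P.primV G (x : Circ) ∂w :=
      integral_circ (m := P.dW) (hF.aestronglyMeasurable.mul hc2.aestronglyMeasurable)
    rw [this]
    refine integral_congr_ae ?_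
    filter_upwards [ae_restrict_mem measurableSet_Ioc] with t ht
    have h2 : (fun x : ℝ => Tᶜ.indicator (fun z : ℝ × ℝ => F z.1 * G z.2) (t, x)) =
        fun x => (Set.Iio t).indicator (fun x : ℝ => F t * G x) x := by
      funext x
      simp only [Set.indicator_apply, hT, Set.mem_compl_iff, Set.mem_ofPred_eq, Set.mem_Iio, not_le]
    rw [h2, integral_indicator measurableSet_Iio, hv, Measure.restrict_restrict measurableSet_Iio,
      integral_const_mul, primV, rep_coe ht]
    congr 3
    ext x
    simp only [Set.mem_Ioc, Set.mem_Ioo, Set.mem_inter_iff, Set.mem_Iio]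
    exact ⟨fun h => ⟨h.2, h.1, h.2.le.trans ht.2⟩, fun h => ⟨h.2.1, h.1⟩⟩
  rw [e1, e2, ← integral_add (hH.indicator hTm) (hH.indicator hTm.compl)]
  have e3 : ∀ z, T.indicator (fun z : ℝ × ℝ => F z.1 * G z.2) z +
      Tᶜ.indicator (fun z : ℝ × ℝ => F z.1 * G z.2) z = F z.1 * G z.2 := fun z =>
    Set.indicator_self_add_compl_apply T _ z
  simp only [e3]
  rw [integral_prod_mul (fun t : ℝ => F t) (fun x : ℝ => G x)]
  have : ∫ t, F (t : Circ) ∂w = 0 := by rw [← hF0, integral_μW hF]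
  rw [this, zero_mul]

/-! ### Injectivity of the primitives -/

/-- A primitive that is a.e. constant with respect to the *other* measure has zero density:
one-sided continuity and full support make it constant everywhere. -/
theorem ae_eq_zero_of_primW_ae_eq (hF : Integrable F P.μW) (h0 : ∫ x, F x ∂P.μW = 0) {c : ℝ}
    (h : ∀ᵐ x ∂P.μV, P.primW F x = c) : F =ᵐ[P.μW] 0 := by
  have hi := integrableOn_dW hF
  set p := lowPrim P.dW (fun x : ℝ => F x) with hp
  have h1 : ∀ᵐ x : ℝ ∂P.dV.restrict (Set.Ioc 0 1), p x = c :=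
    (ae_of_ae_map measurable_coe.aemeasurable h).mono fun x hx => by
      rw [← hx, primW_coe hF h0]
  have h2 : ∀ x ∈ Set.Ico (0 : ℝ) 1, p x = c := fun x hx =>
    eq_of_ae_eq_of_rightCont (fun a b => P.dV_Ioo_pos) ((isPrimIoc_lowPrim hi).rightCont hi) h1 hx
  have hc : c = 0 := by
    rw [← h2 0 (by simp), hp]; simp [lowPrim]
  have hFw : Integrable (fun t : ℝ => F t) (P.dW.restrict (Set.Ioc 0 1)) :=
    integrableOn_of_integrable_circ hF
  have hm : MeasurableSet {x | hF.1.mk F x = (0 : Circ → ℝ) x} :=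
    measurableSet_eq_fun hF.1.stronglyMeasurable_mk.measurable measurable_const
  have key : ∀ᵐ t : ℝ ∂P.dW.restrict (Set.Ioc 0 1), F (t : Circ) = 0 := by
    refine ae_eq_zero_of_integral_Iic hFw fun x => ?_
    rw [Measure.restrict_restrict measurableSet_Iic]
    rcases lt_or_ge x 0 with hx | hx
    · rw [show Set.Iic x ∩ Set.Ioc 0 1 = ∅ from Set.eq_empty_of_forall_notMem fun y hy =>
        absurd (hy.2.1.trans_le hy.1) (not_lt.2 hx.le)]
      simp
    rcases lt_or_ge x 1 with hx1 | hx1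
    · rw [show Set.Iic x ∩ Set.Ioc 0 1 = Set.Ioc 0 x from Set.ext fun y =>
        ⟨fun hy => ⟨hy.2.1, hy.1⟩, fun hy => ⟨hy.2, hy.1, hy.2.trans hx1.le⟩⟩]
      rw [← lowPrim_of_nonneg hx, ← hp, h2 x ⟨hx, hx1⟩, hc]
    · rw [Set.inter_eq_self_of_subset_right fun y hy => hy.2.trans hx1, ← integral_μW hF, h0]
  refine hF.1.ae_eq_mk.trans ((ae_circ_iff (m := P.dW) hm).2 ?_)
  filter_upwards [key, ae_of_ae_map measurable_coe.aemeasurable hF.1.ae_eq_mk] with t h3 h4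
  rw [← h4, h3]; rfl

theorem ae_eq_zero_of_primV_ae_eq (hG : Integrable G P.μV) (h0 : ∫ x, G x ∂P.μV = 0) {c : ℝ}
    (h : ∀ᵐ x ∂P.μW, P.primV G x = c) : G =ᵐ[P.μV] 0 := by
  have hi := integrableOn_dV hG
  set p := lowPrimLeft P.dV (fun x : ℝ => G x) with hp
  have h1 : ∀ᵐ x : ℝ ∂P.dW.restrict (Set.Ioc 0 1), p x = c :=
    (ae_of_ae_map measurable_coe.aemeasurable h).mono fun x hx => by
      rw [← hx, primV_coe hG h0]
  have h2 : ∀ x ∈ Set.Ioc (0 : ℝ) 1, p x = c := fun x hx =>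
    eq_of_ae_eq_of_leftCont (fun a b => P.dW_Ioo_pos)
      ((isPrimIco_lowPrimLeft hi).leftCont hi) h1 hx
  -- the intervals `(0, y)` shrink to the empty set as `y` decreases to `0`
  have hc : c = 0 := by
    have h3 := tendsto_setIntegral_of_eventually_mem_iff (l := 𝓝[>] (0 : ℝ))
      (s := fun y => Set.Ioo 0 y) (s₀ := ∅) (hi 0 1) (fun y => measurableSet_Ioo)
      MeasurableSet.empty ((eventually_mem_Ioo_right 0).mono fun y hy t ht =>
        ⟨ht.1.le, by linarith [hy.2, ht.2]⟩) (Set.empty_subset _) fun t => by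
          simp only [Set.mem_empty_iff_false, iff_false]
          rcases le_or_gt t 0 with ht | ht
          · exact Eventually.of_forall fun y hy => absurd hy.1 (not_lt.2 ht)
          · exact (eventually_gt_of_lt ht).mono fun y hy h => absurd h.2 (not_lt.2 hy.le)
    rw [Measure.restrict_empty, integral_zero_measure] at h3
    refine tendsto_nhds_unique (tendsto_const_nhds.congr' ?_) h3
    filter_upwards [eventually_mem_Ioo_right 0] with y hy
    rw [← lowPrimLeft_of_pos hi hy.1, ← hp, h2 y ⟨hy.1, by linarith [hy.2]⟩]
  have hGv : Integrable (fun t : ℝ => G t) (P.dV.restrict (Set.Ioc 0 1)) :=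
    integrableOn_of_integrable_circ hG
  have hm : MeasurableSet {x | hG.1.mk G x = (0 : Circ → ℝ) x} :=
    measurableSet_eq_fun hG.1.stronglyMeasurable_mk.measurable measurable_const
  have key : ∀ᵐ t : ℝ ∂P.dV.restrict (Set.Ioc 0 1), G (t : Circ) = 0 := by
    refine ae_eq_zero_of_integral_Ici hGv fun x => ?_
    rw [Measure.restrict_restrict measurableSet_Ici]
    rcases le_or_gt x 0 with hx | hx
    · have hsub : Set.Ioc (0 : ℝ) 1 ⊆ Set.Ici x := fun y hy => hx.trans hy.1.le
      rw [Set.inter_eq_self_of_subset_right hsub, ← integral_μV hG, h0]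
    rcases le_or_gt x 1 with hx1 | hx1
    · rw [show Set.Ici x ∩ Set.Ioc 0 1 = Set.Icc x 1 from Set.ext fun y =>
        ⟨fun hy => ⟨hy.1, hy.2.2⟩, fun hy => ⟨hy.1, hx.trans_le hy.1, hy.2⟩⟩]
      have h3 : ∫ t in Set.Ioc (0 : ℝ) 1, G (t : Circ) ∂P.dV =
          (∫ t in Set.Ioo 0 x, G (t : Circ) ∂P.dV) + ∫ t in Set.Icc x 1, G (t : Circ) ∂P.dV := by
        rw [← setIntegral_union _ measurableSet_Icc ((hi 0 x).mono_set Set.Ioo_subset_Icc_self)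
          (hi x 1), Set.Ioo_union_Icc_eq_Ioc hx hx1]
        exact Set.disjoint_left.2 fun y hy hy' => absurd hy.2 (not_lt.2 hy'.1)
      rw [← integral_μV hG, h0, ← lowPrimLeft_of_pos hi hx, ← hp, h2 x ⟨hx, hx1⟩, hc] at h3
      linarith
    · rw [show Set.Ici x ∩ Set.Ioc 0 1 = ∅ from Set.eq_empty_of_forall_notMem fun y hy =>
        absurd (hy.1.trans hy.2.2) (not_le.2 hx1)]
      simp
  refine hG.1.ae_eq_mk.trans ((ae_circ_iff (m := P.dV) hm).2 ?_)
  filter_upwards [key, ae_of_ae_map measurable_coe.aemeasurable hG.1.ae_eq_mk] with t h3 h4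
  rw [← h4, h3]; rfl

/-! ### The centered primitives -/

variable (P) in
/-- The primitive of mean zero of the mean-zero part of `F` with respect to `dW`. -/
def aOp (F : Circ → ℝ) : Circ → ℝ := center P.μV (P.primW (center P.μW F))

variable (P) in
/-- The primitive of mean zero of the mean-zero part of `G` with respect to `dV`. -/
def bOp (G : Circ → ℝ) : Circ → ℝ := center P.μW (P.primV (center P.μV G))

theorem cadlag_primW_center (hF : Integrable F P.μW) : Cadlag (P.primW (center P.μW F)) :=
  cadlag_primW (integrable_center hF) (integral_center hF)

theorem caglad_primV_center (hG : Integrable G P.μV) : Caglad (P.primV (center P.μV G)) :=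
  caglad_primV (integrable_center hG) (integral_center hG)

theorem integrable_primW_center (hF : Integrable F P.μW) :
    Integrable (P.primW (center P.μW F)) P.μV :=
  ((cadlag_primW_center hF).memLp P.μV 1).integrable le_rfl

theorem integrable_primV_center (hG : Integrable G P.μV) :
    Integrable (P.primV (center P.μV G)) P.μW :=
  ((caglad_primV_center hG).memLp P.μW 1).integrable le_rfl

theorem cadlag_aOp (hF : Integrable F P.μW) : Cadlag (P.aOp F) := by
  rw [aOp, center_eq_add_const]
  exact (cadlag_primW_center hF).add_const _

theorem caglad_bOp (hG : Integrable G P.μV) : Caglad (P.bOp G) := by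
  rw [bOp, center_eq_add_const]
  exact (caglad_primV_center hG).add_const _

theorem integral_aOp (hF : Integrable F P.μW) : ∫ x, P.aOp F x ∂P.μV = 0 :=
  integral_center (integrable_primW_center hF)

theorem integral_bOp (hG : Integrable G P.μV) : ∫ x, P.bOp G x ∂P.μW = 0 :=
  integral_center (integrable_primV_center hG)

theorem hasLeftDeriv_aOp (hF : Caglad F) (h0 : ∫ x, F x ∂P.μW = 0) :
    HasLeftDeriv P.W (P.aOp F) F := by
  rw [aOp, center_of_integral_eq_zero h0, center_eq_add_const]
  exact
    (hasLeftDeriv_primW hF h0).add_const _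

theorem hasRightDeriv_bOp (hG : Cadlag G) (h0 : ∫ x, G x ∂P.μV = 0) :
    HasRightDeriv P.V (P.bOp G) G := by
  rw [bOp, center_of_integral_eq_zero h0, center_eq_add_const]
  exact
    (hasRightDeriv_primV hG h0).add_const _

theorem center_eq_aOp (hu : Cadlag u) (hF : Caglad F) (h : HasLeftDeriv P.W u F) :
    ∫ x, F x ∂P.μW = 0 ∧ center P.μV u = P.aOp F := by
  obtain ⟨h0, c, rfl⟩ := eq_primW_add_const hu hF h
  have hi := (hF.memLp P.μW 1).integrable le_rfl
  refine ⟨h0, ?_⟩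
  rw [aOp, center_of_integral_eq_zero h0,
    center_add_const (((cadlag_primW hi h0).memLp P.μV 1).integrable le_rfl)]

theorem center_eq_bOp (hg : Caglad g) (hG : Cadlag G) (h : HasRightDeriv P.V g G) :
    ∫ x, G x ∂P.μV = 0 ∧ center P.μW g = P.bOp G := by
  obtain ⟨h0, c, rfl⟩ := eq_primV_add_const hg hG h
  have hi := (hG.memLp P.μV 1).integrable le_rfl
  refine ⟨h0, ?_⟩
  rw [bOp, center_of_integral_eq_zero h0,
    center_add_const (((caglad_primV hi h0).memLp P.μW 1).integrable le_rfl)]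

theorem aOp_congr (h : F =ᵐ[P.μW] F') : P.aOp F = P.aOp F' := by
  rw [aOp, aOp, primW_congr (center_congr h)]

theorem bOp_congr (h : G =ᵐ[P.μV] G') : P.bOp G = P.bOp G' := by
  rw [bOp, bOp, primV_congr (center_congr h)]

theorem aOp_center (hF : Integrable F P.μW) : P.aOp (center P.μW F) = P.aOp F := by
  rw [aOp, aOp, center_center hF]

theorem aOp_add (hF : Integrable F P.μW) (hF' : Integrable F' P.μW) :
    P.aOp (fun x => F x + F' x) = fun x => P.aOp F x + P.aOp F' x := by
  rw [aOp, center_add hF hF', funext (primW_add (integrable_center hF) (integrable_center hF')),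
    center_add (integrable_primW_center hF) (integrable_primW_center hF')]
  rfl

theorem aOp_const_mul (c : ℝ) (F : Circ → ℝ) :
    P.aOp (fun x => c * F x) = fun x => c * P.aOp F x := by
  rw [aOp, center_const_mul]
  have : P.primW (fun x => c * center P.μW F x) = fun x => c * P.primW (center P.μW F) x :=
    funext fun x => integral_const_mul _ _
  rw [this, center_const_mul]
  rfl

theorem abs_aOp_le (hF : Integrable F P.μW) (x : Circ) :
    |P.aOp F x| ≤ 4 * ∫ y, |F y| ∂P.μW := by
  have h1 := abs_center_le (μ := P.μV) (abs_primW_le (integrable_center hF)) x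
  have h2 := integral_abs_center_le hF
  unfold aOp
  linarith

/-- `aOp` and `-bOp` are adjoint to each other. -/
theorem integral_aOp_mul (hF : Integrable F P.μW) (hG : Integrable G P.μV) :
    ∫ x, P.aOp F x * G x ∂P.μV = - ∫ x, F x * P.bOp G x ∂P.μW := by
  have h := integral_primW_mul_add (integrable_center hF) (integrable_center hG)
    (integral_center hF) (integral_center hG)
  obtain ⟨C, hC⟩ := (cadlag_primW_center hF).bounded
  obtain ⟨D, hD⟩ := (caglad_primV_center hG).bounded
  have h1 := integral_center_mul (integrable_primW_center hF) hG
    (hG.bdd_mul (cadlag_primW_center hF).measurable.aestronglyMeasurable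
      (Eventually.of_forall hC))
  have h2 := integral_center_mul hF (integrable_primV_center hG)
    (hF.mul_bdd (caglad_primV_center hG).measurable.aestronglyMeasurable
      (Eventually.of_forall hD))
  simp only [aOp, bOp]
  rw [h1, ← h2]
  linarith

theorem center_ae_eq_zero_of_aOp (hF : Integrable F P.μW) (h : P.aOp F =ᵐ[P.μV] 0) :
    center P.μW F =ᵐ[P.μW] 0 :=
  ae_eq_zero_of_primW_ae_eq (integrable_center hF) (integral_center hF)
    (h.mono fun _ hx => sub_eq_zero.1 hx)

theorem center_ae_eq_zero_of_bOp (hG : Integrable G P.μV) (h : P.bOp G =ᵐ[P.μW] 0) :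
    center P.μV G =ᵐ[P.μV] 0 :=
  ae_eq_zero_of_primV_ae_eq (integrable_center hG) (integral_center hG)
    (h.mono fun _ hx => sub_eq_zero.1 hx)

end Weights

/-! ### Backward orbits of an operator with dense range -/

/-- A Mittag-Leffler argument: if a bounded operator `S` of a Banach space has dense range, then
the points with an infinite backward orbit under `S` are dense. -/
theorem dense_backward_orbits {H : Type*} [NormedAddCommGroup H] [NormedSpace ℝ H]
    [CompleteSpace H] (S : H →L[ℝ] H) (hS : DenseRange S) :
    Dense {x | ∃ z : ℕ → H, z 0 = x ∧ ∀ n, z n = S (z (n + 1))} := by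
  rw [Metric.dense_iff]
  intro x ε hε
  set M : ℝ := max 1 ‖S‖ with hM
  have hM1 : 1 ≤ M := le_max_left _ _
  have hM0 : 0 < M := by positivity
  -- the errors `δ / 2 ^ k` add up to `2 δ < ε`
  set δ : ℝ := ε / 4 with hδ
  have hδ0 : 0 < δ := by positivity
  have hpre : ∀ (n : ℕ) (y : H), ∃ y', ‖y - S y'‖ < δ / M ^ n * (1 / 2) ^ n := fun n y => by
    obtain ⟨y', hy'⟩ := hS.exists_dist_lt y (show 0 < δ / M ^ n * (1 / 2) ^ n by positivity)
    exact ⟨y', by rwa [dist_eq_norm] at hy'⟩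
  choose pre hpre using hpre
  -- `y` is an approximate backward orbit; the powers of `M` in its errors absorb those of `S`
  let y : ℕ → H := fun n => Nat.rec x (fun n y => pre n y) n
  have hy : ∀ n, ‖y n - S (y (n + 1))‖ < δ / M ^ n * (1 / 2) ^ n := fun n => hpre n (y n)
  have hpow : ∀ (k : ℕ) (v : H), ‖(S ^ k) v‖ ≤ M ^ k * ‖v‖ := fun k v => by
    refine ((S ^ k).le_opNorm v).trans (mul_le_mul_of_nonneg_right ?_ (norm_nonneg _))
    induction k with
    | zero => simpa using! ContinuousLinearMap.norm_id_le (𝕜 := ℝ) (E := H)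
    | succ k ih =>
      rw [pow_succ, pow_succ]
      exact (norm_mul_le _ _).trans
        (mul_le_mul ih (le_max_right _ _) (norm_nonneg _) (by positivity))
  have hdist : ∀ n k, dist ((S ^ k) (y (n + k))) ((S ^ (k + 1)) (y (n + (k + 1)))) ≤
      δ * (1 / 2) ^ k := fun n k => by
    rw [dist_eq_norm, pow_succ, mul_apply_eq_comp, ← map_sub]
    refine (hpow k _).trans ?_
    have h1 := (hy (n + k)).le
    calc M ^ k * ‖y (n + k) - S (y (n + (k + 1)))‖
        ≤ M ^ k * (δ / M ^ (n + k) * (1 / 2) ^ (n + k)) :=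
          mul_le_mul_of_nonneg_left h1 (by positivity)
      _ = δ * (1 / 2) ^ k * ((1 / 2) ^ n / M ^ n) := by
          rw [pow_add, pow_add]; field_simp
      _ ≤ δ * (1 / 2) ^ k * 1 := by
          refine mul_le_mul_of_nonneg_left ?_ (by positivity)
          rw [div_le_one (by positivity)]
          exact (pow_le_one₀ (by norm_num) (by norm_num)).trans (one_le_pow₀ hM1)
      _ = δ * (1 / 2) ^ k := mul_one _
  have hlim : ∀ n, ∃ z, Tendsto (fun k => (S ^ k) (y (n + k))) atTop (𝓝 z) := fun n =>
    cauchySeq_tendsto_of_complete (cauchySeq_of_le_geometric _ _ (by norm_num) (hdist n))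
  choose z hz using hlim
  refine ⟨z 0, ?_, z, rfl, fun n => ?_⟩
  · have h1 := dist_le_of_le_geometric_of_tendsto₀ _ _ (by norm_num) (hdist 0) (hz 0)
    have h2 : dist x (z 0) ≤ δ / (1 - 1 / 2) := by simpa [y] using h1
    rw [Metric.mem_ball, dist_comm]
    refine h2.trans_lt ?_
    rw [hδ]; norm_num; linarith
  · have h1 := (S.continuous.tendsto _).comp (hz (n + 1))
    have h2 := (hz n).comp (tendsto_add_atTop_nat 1)
    refine tendsto_nhds_unique h2 (h1.congr fun k => ?_)
    simp only [Function.comp]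
    rw [pow_succ', mul_apply_eq_comp, show n + (k + 1) = n + 1 + k by ring]

/-! ### Real `L²` spaces of finite measures -/

section L2

variable {μ : Measure Circ}

theorem integrable_coe_Lp [IsFiniteMeasure μ] (f : Lp ℝ 2 μ) : Integrable f μ :=
  (Lp.memLp f).integrable one_le_two

theorem inner_eq_integral (f g : Lp ℝ 2 μ) : inner ℝ f g = ∫ x, f x * g x ∂μ := by
  rw [L2.inner_def]
  refine integral_congr_ae (Eventually.of_forall fun x => ?_)
  simp [mul_comm]

theorem inner_toLp_left {u : Circ → ℝ} (hu : MemLp u 2 μ) (g : Lp ℝ 2 μ) :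
    inner ℝ (hu.toLp u) g = ∫ x, u x * g x ∂μ := by
  rw [inner_eq_integral]
  refine integral_congr_ae ?_
  filter_upwards [hu.coeFn_toLp] with x hx
  rw [hx]

theorem norm_toLp_sq {u : Circ → ℝ} (hu : MemLp u 2 μ) :
    ‖hu.toLp u‖ ^ 2 = ∫ x, u x * u x ∂μ := by
  rw [← real_inner_self_eq_norm_sq, inner_toLp_left]
  refine integral_congr_ae ?_
  filter_upwards [hu.coeFn_toLp] with x hx
  rw [hx]

variable [IsFiniteMeasure μ]

theorem inner_const_one (f : Lp ℝ 2 μ) : inner ℝ (Lp.const 2 μ (1 : ℝ)) f = ∫ x, f x ∂μ := by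
  rw [inner_eq_integral]
  refine integral_congr_ae ?_
  filter_upwards [Lp.coeFn_const 2 μ (1 : ℝ)] with x hx
  rw [hx]; simp

/-- The Cauchy–Schwarz bound of the `L¹` norm by the `L²` norm. -/
theorem integral_abs_le_norm (f : Lp ℝ 2 μ) :
    ∫ x, |f x| ∂μ ≤ ‖Lp.const 2 μ (1 : ℝ)‖ * ‖f‖ := by
  have h := real_inner_le_norm (Lp.const 2 μ (1 : ℝ)) |f|
  rw [inner_const_one, norm_abs_eq_norm] at h
  refine le_trans (le_of_eq (integral_congr_ae ?_)) h
  filter_upwards [Lp.coeFn_abs f] with x hx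
  rw [hx]

variable (μ) in
/-- The orthogonal projection of `L²` onto the functions of mean zero. -/
def centerLp : Lp ℝ 2 μ →L[ℝ] Lp ℝ 2 μ :=
  ContinuousLinearMap.id ℝ _ - (μ.real Set.univ)⁻¹ •
    (innerSL ℝ (Lp.const 2 μ (1 : ℝ))).smulRight (Lp.const 2 μ (1 : ℝ))

theorem coeFn_centerLp (f : Lp ℝ 2 μ) : centerLp μ f =ᵐ[μ] center μ f := by
  have h : centerLp μ f = f - ((μ.real Set.univ)⁻¹ * ∫ x, f x ∂μ) • Lp.const 2 μ (1 : ℝ) := by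
    simp [centerLp, inner_const_one, smul_smul]
  rw [h]
  filter_upwards [Lp.coeFn_sub f (((μ.real Set.univ)⁻¹ * ∫ x, f x ∂μ) • Lp.const 2 μ (1 : ℝ)),
    Lp.coeFn_smul ((μ.real Set.univ)⁻¹ * ∫ x, f x ∂μ) (Lp.const 2 μ (1 : ℝ)),
    Lp.coeFn_const 2 μ (1 : ℝ)] with x h1 h2 h3
  rw [h1, Pi.sub_apply, h2, Pi.smul_apply, h3]
  simp [center, div_eq_inv_mul]

end L2

namespace Weights

variable {P : Weights}

theorem memLp_aOp (F : Lp ℝ 2 P.μW) : MemLp (P.aOp F) 2 P.μV :=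
  (cadlag_aOp (integrable_coe_Lp F)).memLp _ _

theorem memLp_bOp (G : Lp ℝ 2 P.μV) : MemLp (P.bOp G) 2 P.μW :=
  (caglad_bOp (integrable_coe_Lp G)).memLp _ _

variable (P) in
/-- The centered primitive as a bounded operator from `L²_W` to `L²_V`. -/
def aLp : Lp ℝ 2 P.μW →L[ℝ] Lp ℝ 2 P.μV :=
  LinearMap.mkContinuous
    { toFun := fun F => (memLp_aOp F).toLp (P.aOp F)
      map_add' := fun F F' => by
        rw [← MemLp.toLp_add]
        refine MemLp.toLp_congr _ _ (Eventually.of_forall fun x => ?_)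
        rw [aOp_congr (Lp.coeFn_add F F')]
        exact congrFun (aOp_add (integrable_coe_Lp F) (integrable_coe_Lp F')) x
      map_smul' := fun c F => by
        rw [RingHom.id_apply, ← MemLp.toLp_const_smul]
        refine MemLp.toLp_congr _ _ (Eventually.of_forall fun x => ?_)
        rw [aOp_congr (Lp.coeFn_smul c F)]
        exact congrFun (aOp_const_mul c F) x }
    (measureUnivNNReal P.μV ^ (2 : ENNReal).toReal⁻¹ * (4 * ‖Lp.const 2 P.μW (1 : ℝ)‖)) fun F => by
      have h1 := Lp.norm_le_of_ae_bound (f := (memLp_aOp F).toLp (P.aOp F))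
        (C := 4 * (‖Lp.const 2 P.μW (1 : ℝ)‖ * ‖F‖)) (by positivity) (by
          filter_upwards [(memLp_aOp F).coeFn_toLp] with x hx
          rw [hx, Real.norm_eq_abs]
          linarith [abs_aOp_le (integrable_coe_Lp F) x, integral_abs_le_norm F])
      refine h1.trans (le_of_eq ?_)
      ring

theorem aLp_apply (F : Lp ℝ 2 P.μW) : P.aLp F = (memLp_aOp F).toLp (P.aOp F) := rfl

theorem coeFn_aLp (F : Lp ℝ 2 P.μW) : P.aLp F =ᵐ[P.μV] P.aOp F := (memLp_aOp F).coeFn_toLp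

theorem adjoint_aLp_apply (G : Lp ℝ 2 P.μV) :
    ContinuousLinearMap.adjoint P.aLp G = -(memLp_bOp G).toLp (P.bOp G) := by
  refine ext_inner_right ℝ fun F => ?_
  rw [ContinuousLinearMap.adjoint_inner_left, inner_neg_left, inner_toLp_left, real_inner_comm,
    aLp_apply, inner_toLp_left, integral_aOp_mul (integrable_coe_Lp F) (integrable_coe_Lp G)]
  simp only [mul_comm]

theorem coeFn_adjoint_aLp (G : Lp ℝ 2 P.μV) :
    ContinuousLinearMap.adjoint P.aLp G =ᵐ[P.μW] fun x => -P.bOp G x := by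
  rw [adjoint_aLp_apply]
  filter_upwards [Lp.coeFn_neg ((memLp_bOp G).toLp (P.bOp G)), (memLp_bOp G).coeFn_toLp]
    with x h1 h2
  rw [h1, Pi.neg_apply, h2]

variable (P) in
/-- The operator `F ↦ ∫ F dW + A† A F` of `L²_W`, with `A` the centered primitive. Up to constants
it inverts `-D_W⁻ D_V⁺`. -/
def smoothing : Lp ℝ 2 P.μW →L[ℝ] Lp ℝ 2 P.μW :=
  (innerSL ℝ (Lp.const 2 P.μW (1 : ℝ))).smulRight (Lp.const 2 P.μW (1 : ℝ)) +
    (ContinuousLinearMap.adjoint P.aLp) ∘L P.aLp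

theorem smoothing_apply (F : Lp ℝ 2 P.μW) :
    P.smoothing F = (∫ x, F x ∂P.μW) • Lp.const 2 P.μW (1 : ℝ) +
      ContinuousLinearMap.adjoint P.aLp (P.aLp F) := by
  simp [smoothing, inner_const_one]

theorem coeFn_smoothing (F : Lp ℝ 2 P.μW) :
    P.smoothing F =ᵐ[P.μW] fun x => -P.bOp (P.aOp F) x + ∫ x, F x ∂P.μW := by
  rw [smoothing_apply]
  filter_upwards [Lp.coeFn_add ((∫ x, F x ∂P.μW) • Lp.const 2 P.μW (1 : ℝ))
      (ContinuousLinearMap.adjoint P.aLp (P.aLp F)),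
    Lp.coeFn_smul (∫ x, F x ∂P.μW) (Lp.const 2 P.μW (1 : ℝ)), Lp.coeFn_const 2 P.μW (1 : ℝ),
    coeFn_adjoint_aLp (P.aLp F)] with x h1 h2 h3 h4
  rw [h1, Pi.add_apply, h2, Pi.smul_apply, h3, h4, bOp_congr (coeFn_aLp F)]
  simp [add_comm]

theorem aLp_injective_of_integral_eq_zero {F : Lp ℝ 2 P.μW} (h0 : ∫ x, F x ∂P.μW = 0)
    (h : P.aLp F = 0) : F = 0 := by
  have h1 : P.aOp F =ᵐ[P.μV] 0 := by
    filter_upwards [coeFn_aLp F, Lp.coeFn_zero ℝ 2 P.μV] with x h2 h3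
    rw [← h2, h, h3]
  have h2 := center_ae_eq_zero_of_aOp (integrable_coe_Lp F) h1
  rw [center_of_integral_eq_zero h0] at h2
  exact Lp.ext (h2.trans (Lp.coeFn_zero ℝ 2 P.μW).symm)

/-- If `F` is orthogonal to the range of `smoothing`, then
`0 = ⟪smoothing F, F⟫ = (∫ F dW)² + ‖A F‖²`, which forces `F = 0`. -/
theorem denseRange_smoothing : DenseRange P.smoothing := by
  have h : (LinearMap.range
      (P.smoothing : Lp ℝ 2 P.μW →ₗ[ℝ] Lp ℝ 2 P.μW)).topologicalClosure = ⊤ := by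
    rw [Submodule.topologicalClosure_eq_top_iff, Submodule.eq_bot_iff]
    intro F hF
    have h1 := (Submodule.mem_orthogonal _ F).1 hF (P.smoothing F) ⟨F, rfl⟩
    rw [smoothing_apply, inner_add_left, real_inner_smul_left, inner_const_one,
      ContinuousLinearMap.adjoint_inner_left, real_inner_self_eq_norm_sq] at h1
    have h2 := mul_self_nonneg (∫ x, F x ∂P.μW)
    have h3 := sq_nonneg ‖P.aLp F‖
    refine aLp_injective_of_integral_eq_zero (mul_self_eq_zero.1 (by linarith)) ?_
    exact norm_eq_zero.1 (pow_eq_zero_iff two_ne_zero |>.1 (by linarith))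
  have h2 := (Submodule.dense_iff_topologicalClosure_eq_top).2 h
  exact h2

/-! ### Test functions -/

/-- The iterated derivatives of `a 0` run along any chain `D_V⁺ a k = b k`,
`D_W⁻ b k = a (k + 1)`. -/
theorem iterDerivVW_eq {a b : ℕ → Circ → ℝ} (hab : ∀ k, HasRightDeriv P.V (a k) (b k))
    (hba : ∀ k, HasLeftDeriv P.W (b k) (a (k + 1))) (k : ℕ) :
    P.iterDerivVW (2 * k) (a 0) = a k ∧ P.iterDerivVW (2 * k + 1) (a 0) = b k := by
  have step : ∀ k, P.iterDerivVW (2 * k) (a 0) = a k → P.iterDerivVW (2 * k + 1) (a 0) = b k := by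
    intro k hk
    rw [iterDerivVW, if_pos (even_two_mul k), hk, (hab k).rightDeriv_eq]
  induction k with
  | zero => exact ⟨rfl, step 0 rfl⟩
  | succ k ih =>
    have h1 : P.iterDerivVW (2 * (k + 1)) (a 0) = a (k + 1) := by
      rw [show 2 * (k + 1) = 2 * k + 1 + 1 by ring, iterDerivVW,
        if_neg (Nat.not_even_iff_odd.2 (odd_two_mul_add_one k)), ih.2, (hba k).leftDeriv_eq]
    exact ⟨h1, step _ h1⟩

theorem mem_CinftyVW0_of_chain {a b : ℕ → Circ → ℝ} (hab : ∀ k, HasRightDeriv P.V (a k) (b k))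
    (hba : ∀ k, HasLeftDeriv P.W (b k) (a (k + 1))) (ha : ∀ k, a k ∈ P.C1)
    (hb : ∀ k, b k ∈ P.C0) : a 0 ∈ P.CinftyVW0 := by
  refine Set.mem_iInter.2 fun n k _ => ⟨fun j _ => ?_, ?_⟩
  · rcases Nat.even_or_odd' j with ⟨i, rfl | rfl⟩
    · rw [if_pos (even_two_mul i), (iterDerivVW_eq hab hba i).1]
      exact ⟨_, hab i⟩
    · rw [if_neg (Nat.not_even_iff_odd.2 (odd_two_mul_add_one i)), (iterDerivVW_eq hab hba i).2]
      exact ⟨_, hba i⟩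
  · rcases Nat.even_or_odd' k with ⟨i, rfl | rfl⟩
    · rw [if_pos (even_two_mul i), (iterDerivVW_eq hab hba i).1]
      exact ha i
    · rw [if_neg (Nat.not_even_iff_odd.2 (odd_two_mul_add_one i)), (iterDerivVW_eq hab hba i).2]
      exact hb i

variable (P) in
/-- The elements of `L²_W` with an infinite backward orbit under `smoothing`. -/
def smoothVectors : Set (Lp ℝ 2 P.μW) :=
  {F | ∃ z : ℕ → Lp ℝ 2 P.μW, z 0 = F ∧ ∀ n, z n = P.smoothing (z (n + 1))}

theorem dense_smoothVectors : Dense P.smoothVectors :=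
  dense_backward_orbits _ denseRange_smoothing

theorem integrable_aOp (F : Lp ℝ 2 P.μW) : Integrable (P.aOp F) P.μV :=
  (memLp_aOp F).integrable one_le_two

theorem center_smoothing (F : Lp ℝ 2 P.μW) :
    center P.μW (P.smoothing F) =ᵐ[P.μW] fun x => -P.bOp (P.aOp F) x := by
  have h0 : ∫ x, -P.bOp (P.aOp F) x ∂P.μW = 0 := by
    rw [integral_neg, integral_bOp (integrable_aOp F), neg_zero]
  have hi : Integrable (fun x => -P.bOp (P.aOp F) x) P.μW :=
    (((caglad_bOp (integrable_aOp F)).memLp P.μW 1).integrable le_rfl).neg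
  have h1 := center_congr (coeFn_smoothing F)
  rwa [center_add_const hi, center_of_integral_eq_zero h0] at h1

theorem caglad_neg_bOp_aOp (F : Lp ℝ 2 P.μW) : Caglad fun x => -P.bOp (P.aOp F) x := by
  simpa using (caglad_bOp (integrable_aOp F)).const_mul (-1)

theorem integral_neg_bOp_aOp (F : Lp ℝ 2 P.μW) : ∫ x, -P.bOp (P.aOp F) x ∂P.μW = 0 := by
  rw [integral_neg, integral_bOp (integrable_aOp F), neg_zero]

theorem hasRightDeriv_neg_bOp_aOp (F : Lp ℝ 2 P.μW) :
    HasRightDeriv P.V (fun x => -P.bOp (P.aOp F) x) fun x => -P.aOp F x := by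
  simpa using (hasRightDeriv_bOp (cadlag_aOp (integrable_coe_Lp F))
    (integral_aOp (integrable_coe_Lp F))).const_mul (-1)

theorem hasLeftDeriv_aOp_smoothing (F : Lp ℝ 2 P.μW) :
    HasLeftDeriv P.W (P.aOp (P.smoothing F)) fun x => -P.bOp (P.aOp F) x := by
  rw [← aOp_center (integrable_coe_Lp _), aOp_congr (center_smoothing F)]
  exact hasLeftDeriv_aOp (caglad_neg_bOp_aOp F) (integral_neg_bOp_aOp F)

/-- A smooth vector `F = z 0` with backward orbit `z` gives the test function `A† A F`, whose
iterated derivatives are, up to sign, `A z₀, A† A z₁, A z₁, A† A z₂, …`. -/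
theorem neg_bOp_aOp_mem_CinftyVW0 {F : Lp ℝ 2 P.μW} (hF : F ∈ P.smoothVectors) :
    (fun x => -P.bOp (P.aOp F) x) ∈ P.CinftyVW0 := by
  obtain ⟨z, rfl, hz⟩ := hF
  have h := mem_CinftyVW0_of_chain (P := P)
    (a := fun k x => (-1) ^ k * -P.bOp (P.aOp (z k)) x)
    (b := fun k x => (-1) ^ k * -P.aOp (z k) x)
    (fun k => (hasRightDeriv_neg_bOp_aOp (z k)).const_mul _) (fun k => ?_) (fun k => ⟨?_, ?_⟩)
    (fun k => ⟨?_, ?_⟩)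
  · simpa using h
  · have h1 := (hasLeftDeriv_aOp_smoothing (z (k + 1))).const_mul ((-1) ^ (k + 1))
    rw [← hz k] at h1
    have e : (fun x => (-1) ^ (k + 1) * P.aOp (z k) x) = fun x => (-1) ^ k * -P.aOp (z k) x := by
      funext x; ring
    rwa [e] at h1
  · exact (caglad_neg_bOp_aOp (z k)).const_mul _
  · rw [integral_const_mul, integral_neg_bOp_aOp, mul_zero]
  · have h1 := (cadlag_aOp (integrable_coe_Lp (z k))).const_mul ((-1) ^ (k + 1))
    have e : (fun x => (-1) ^ (k + 1) * P.aOp (z k) x) = fun x => (-1) ^ k * -P.aOp (z k) x := by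
      funext x; ring
    rwa [e] at h1
  · rw [integral_const_mul, integral_neg, integral_aOp (integrable_coe_Lp (z k)), neg_zero,
      mul_zero]

/-! ### The Sobolev derivative -/

/-- The additive constant in the definition of the Sobolev derivative is removed by subtracting
means. -/
theorem isSobolevDeriv_iff_ae {f : Lp ℝ 2 P.μV} {F : Lp ℝ 2 P.μW} :
    P.IsSobolevDeriv f F ↔ ∫ x, F x ∂P.μW = 0 ∧ center P.μV f =ᵐ[P.μV] P.aOp F := by
  refine and_congr_right fun h0 => ?_
  have hF := integrable_coe_Lp F
  have hprim := cadlag_primW hF h0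
  have hi : Integrable (P.primW F) P.μV := (hprim.memLp P.μV 1).integrable le_rfl
  have key : ∀ c : ℝ, (∀ᵐ x : ℝ ∂P.dV.restrict (Set.Ioc 0 1),
      f (x : Circ) = c + ∫ t in Set.Ioc 0 x, F (t : Circ) ∂P.dW) ↔
      ∀ᵐ x ∂P.μV, f x = P.primW F x + c := fun c => by
    have hm : MeasurableSet {x | f x = P.primW F x + c} :=
      measurableSet_eq_fun (Lp.stronglyMeasurable f).measurable (hprim.measurable.add_const c)
    refine Iff.trans ?_ (ae_circ_iff (m := P.dV) hm).symm
    refine eventually_congr ?_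
    filter_upwards [ae_restrict_mem measurableSet_Ioc] with x hx
    rw [primW, rep_coe hx, add_comm]
  constructor
  · rintro ⟨c, hc⟩
    have h1 := center_congr ((key c).1 hc)
    rw [center_add_const hi] at h1
    rw [aOp, center_of_integral_eq_zero h0]
    exact h1
  · intro h
    refine ⟨(∫ x, f x ∂P.μV) / P.μV.real Set.univ -
      (∫ x, P.primW F x ∂P.μV) / P.μV.real Set.univ, (key _).2 ?_⟩
    filter_upwards [h] with x hx
    rw [aOp, center_of_integral_eq_zero h0] at hx
    simp only [center] at hx
    linarith

theorem isSobolevDeriv_iff {f : Lp ℝ 2 P.μV} {F : Lp ℝ 2 P.μW} :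
    P.IsSobolevDeriv f F ↔ ∫ x, F x ∂P.μW = 0 ∧ centerLp P.μV f = P.aLp F := by
  rw [isSobolevDeriv_iff_ae]
  refine and_congr_right fun _ => ⟨fun h => Lp.ext ?_, fun h => ?_⟩
  · exact (coeFn_centerLp f).trans (h.trans (coeFn_aLp F).symm)
  · refine (coeFn_centerLp f).symm.trans ?_
    rw [h]
    exact coeFn_aLp F

theorem IsSobolevDeriv.unique {f : Lp ℝ 2 P.μV} {F G : Lp ℝ 2 P.μW} (hF : P.IsSobolevDeriv f F)
    (hG : P.IsSobolevDeriv f G) : F = G := by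
  rw [isSobolevDeriv_iff] at hF hG
  rw [← sub_eq_zero]
  refine aLp_injective_of_integral_eq_zero ?_ ?_
  · rw [← inner_const_one, inner_sub_right, inner_const_one, inner_const_one, hF.1, hG.1, sub_self]
  · rw [map_sub, ← hF.2, ← hG.2, sub_self]

/-! ### Weak derivatives -/

/-- Integration by parts; test functions are primitives of their derivatives by
`center_eq_bOp`. -/
theorem IsSobolevDeriv.isWeakDeriv {f : Lp ℝ 2 P.μV} {F : Lp ℝ 2 P.μW}
    (h : P.IsSobolevDeriv f F) : P.IsWeakDeriv f F := by
  obtain ⟨h0, hc⟩ := isSobolevDeriv_iff_ae.1 h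
  have hF := integrable_coe_Lp F
  rintro g ⟨c, g₀, hg₀, rfl⟩
  have hmem := Set.mem_iInter.1 hg₀ 1
  have hcag : Caglad g₀ := (hmem 0 (by norm_num)).2.1
  have hd0 := (hmem 1 le_rfl).1 0 zero_lt_one
  rw [if_pos Even.zero] at hd0
  have hd : HasRightDeriv P.V g₀ (rightDeriv P.V g₀) := RightDifferentiable.hasRightDeriv hd0
  have hcad0 := (hmem 1 le_rfl).2
  rw [if_neg (by norm_num), iterDerivVW, if_pos Even.zero] at hcad0
  have hcad : Cadlag (rightDeriv P.V g₀) := hcad0.1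
  have hd' : HasRightDeriv P.V (fun x => c + g₀ x) (rightDeriv P.V g₀) := by
    simpa only [add_comm c] using hd.add_const c
  rw [hd'.rightDeriv_eq]
  set G := rightDeriv P.V g₀
  obtain ⟨hG0, hG⟩ := center_eq_bOp hcag hcad hd
  have hGi : Integrable G P.μV := (hcad.memLp P.μV 1).integrable le_rfl
  have hg0i : Integrable g₀ P.μW := (hcag.memLp P.μW 1).integrable le_rfl
  have hfG : Integrable (fun x => f x * G x) P.μV := by
    exact (Lp.memLp f).integrable_mul (hcad.memLp P.μV 2)
  have hFg : Integrable (fun x => F x * g₀ x) P.μW := by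
    exact (Lp.memLp F).integrable_mul (hcag.memLp P.μW 2)
  have e1 : ∫ x, f x * G x ∂P.μV = ∫ x, P.aOp F x * G x ∂P.μV := by
    have h1 := integral_center_mul (integrable_coe_Lp f) hGi hfG
    rw [center_of_integral_eq_zero hG0] at h1
    rw [← h1]
    refine integral_congr_ae ?_
    filter_upwards [hc] with x hx
    rw [hx]
  have e2 : ∫ x, F x * (c + g₀ x) ∂P.μW = ∫ x, F x * P.bOp G x ∂P.μW := by
    have h1 := integral_center_mul hF hg0i hFg
    rw [center_of_integral_eq_zero h0, hG] at h1
    rw [← h1]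
    simp only [mul_add]
    rw [integral_add (hF.mul_const c) hFg, integral_mul_const, h0, zero_mul, zero_add]
  rw [e1, e2, integral_aOp_mul hF hGi]

/-- Constants are test functions, so weak derivatives have mean zero. -/
theorem IsWeakDeriv.integral_eq_zero {f : Lp ℝ 2 P.μV} {F : Lp ℝ 2 P.μW}
    (h : P.IsWeakDeriv f F) : ∫ x, F x ∂P.μW = 0 := by
  have hz : (fun _ => 0 : Circ → ℝ) ∈ P.CinftyVW0 :=
    mem_CinftyVW0_of_chain (a := fun _ _ => 0) (b := fun _ _ => 0)
      (fun _ => hasRightDeriv_zero) (fun _ x => by simp)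
      (fun _ => ⟨caglad_zero, by simp⟩) fun _ => ⟨cadlag_zero, by simp⟩
  have h1 := h (fun _ => 1) ⟨1, _, hz, by simp⟩
  have hd : HasRightDeriv P.V (fun _ => 1) fun _ => 0 := fun x => by simp
  rw [hd.rightDeriv_eq] at h1
  simpa [eq_comm] using h1

/-- Testing with `A† A F'` for smooth vectors `F'` shows that `f - A F` is orthogonal to `A F'`,
hence to the range of `A`, hence constant. -/
theorem IsWeakDeriv.isSobolevDeriv {f : Lp ℝ 2 P.μV} {F : Lp ℝ 2 P.μW}
    (h : P.IsWeakDeriv f F) : P.IsSobolevDeriv f F := by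
  have h0 := h.integral_eq_zero
  have hadj : ContinuousLinearMap.adjoint P.aLp (f - P.aLp F) = 0 := by
    refine Dense.eq_zero_of_inner_left ℝ dense_smoothVectors fun F' hF' => ?_
    have hi' := integrable_coe_Lp F'
    have h1 := h _ ⟨0, _, neg_bOp_aOp_mem_CinftyVW0 hF', rfl⟩
    simp only [zero_add] at h1
    rw [(hasRightDeriv_neg_bOp_aOp F').rightDeriv_eq] at h1
    simp only [mul_neg, integral_neg, neg_neg] at h1
    have h2 := integral_aOp_mul (integrable_coe_Lp F) (integrable_aOp F')
    rw [ContinuousLinearMap.adjoint_inner_left, inner_sub_left, sub_eq_zero, real_inner_comm,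
      aLp_apply F', inner_toLp_left, aLp_apply, inner_toLp_left]
    have e : ∫ x, P.aOp F x * (memLp_aOp F').toLp (P.aOp F') x ∂P.μV =
        ∫ x, P.aOp F x * P.aOp F' x ∂P.μV := by
      refine integral_congr_ae ?_
      filter_upwards [(memLp_aOp F').coeFn_toLp] with x hx
      rw [hx]
    rw [e, h2, ← h1, neg_neg]
    simp only [mul_comm]
  set k := f - P.aLp F with hk
  have hb : P.bOp k =ᵐ[P.μW] 0 := by
    filter_upwards [coeFn_adjoint_aLp k, Lp.coeFn_zero ℝ 2 P.μW] with x h1 h2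
    rw [hadj, h2] at h1
    simpa using h1.symm
  have hck := center_ae_eq_zero_of_bOp (integrable_coe_Lp k) hb
  refine isSobolevDeriv_iff_ae.2 ⟨h0, ?_⟩
  have e : (f : Circ → ℝ) =ᵐ[P.μV] fun x => k x + P.aOp F x := by
    filter_upwards [Lp.coeFn_sub f (P.aLp F), coeFn_aLp F] with x h1 h2
    rw [hk, h1, Pi.sub_apply, h2]; ring
  have h3 := center_congr e
  rw [center_add (integrable_coe_Lp k) (integrable_aOp F),
    center_of_integral_eq_zero (f := P.aOp F) (integral_aOp (integrable_coe_Lp F))] at h3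
  filter_upwards [h3, hck] with x h4 h5
  rw [h4, h5]; simp

theorem isWeakDeriv_iff_isSobolevDeriv {f : Lp ℝ 2 P.μV} {F : Lp ℝ 2 P.μW} :
    P.IsWeakDeriv f F ↔ P.IsSobolevDeriv f F :=
  ⟨IsWeakDeriv.isSobolevDeriv, IsSobolevDeriv.isWeakDeriv⟩

/-! ### The energetic space -/

variable (P) in
/-- `F = D_W⁻ u` and `G = D_V⁺ D_W⁻ u` for an element `u` of the domain `𝔇_{W,V}(𝕋)`. -/
structure IsStrong (u F G : Circ → ℝ) : Prop where
  cadlag : Cadlag u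
  hasLeftDeriv : HasLeftDeriv P.W u F
  caglad : Caglad F
  hasRightDeriv : HasRightDeriv P.V F G
  cadlag' : Cadlag G

theorem isStrong_of_mem {u : Circ → ℝ} (hu : u ∈ P.strongDomain) :
    P.IsStrong u (leftDeriv P.W u) (rightDeriv P.V (leftDeriv P.W u)) :=
  ⟨hu.1, hu.2.1.hasLeftDeriv, hu.2.2.1, hu.2.2.2.1.hasRightDeriv, hu.2.2.2.2⟩

section IsStrong

variable {u F G u' F' G' : Circ → ℝ}

theorem IsStrong.leftDeriv_eq (h : P.IsStrong u F G) : leftDeriv P.W u = F :=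
  h.hasLeftDeriv.leftDeriv_eq

theorem IsStrong.rightDeriv_eq (h : P.IsStrong u F G) : rightDeriv P.V (leftDeriv P.W u) = G := by
  rw [h.leftDeriv_eq, h.hasRightDeriv.rightDeriv_eq]

theorem IsStrong.mem (h : P.IsStrong u F G) : u ∈ P.strongDomain := by
  refine ⟨h.cadlag, ⟨F, h.hasLeftDeriv⟩, ?_, ?_, ?_⟩
  · rw [h.leftDeriv_eq]; exact h.caglad
  · rw [h.leftDeriv_eq]; exact ⟨G, h.hasRightDeriv⟩
  · rw [h.rightDeriv_eq]; exact h.cadlag'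

theorem IsStrong.sub (h : P.IsStrong u F G) (h' : P.IsStrong u' F' G') :
    P.IsStrong (fun x => u x - u' x) (fun x => F x - F' x) fun x => G x - G' x :=
  ⟨h.cadlag.sub h'.cadlag, h.hasLeftDeriv.sub h'.hasLeftDeriv, h.caglad.sub h'.caglad,
    h.hasRightDeriv.sub h'.hasRightDeriv, h.cadlag'.sub h'.cadlag'⟩

theorem IsStrong.memLp (h : P.IsStrong u F G) : MemLp u 2 P.μV := h.cadlag.memLp _ _

theorem IsStrong.memLp_deriv (h : P.IsStrong u F G) : MemLp F 2 P.μW := h.caglad.memLp _ _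

/-- The energetic norm is the graph norm of `D_W⁻`. -/
theorem IsStrong.energyNorm_eq (h : P.IsStrong u F G) :
    P.energyNorm u = Real.sqrt (‖h.memLp.toLp u‖ ^ 2 + ‖h.memLp_deriv.toLp F‖ ^ 2) := by
  obtain ⟨hF0, hu⟩ := center_eq_aOp h.cadlag h.caglad h.hasLeftDeriv
  obtain ⟨hG0, hF⟩ := center_eq_bOp h.caglad h.cadlag' h.hasRightDeriv
  have hui : Integrable u P.μV := h.memLp.integrable one_le_two
  have hFi : Integrable F P.μW := h.memLp_deriv.integrable one_le_two
  have hG2 : MemLp G 2 P.μV := h.cadlag'.memLp _ _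
  have hGi : Integrable G P.μV := hG2.integrable one_le_two
  have huG : Integrable (fun x => u x * G x) P.μV := h.memLp.integrable_mul hG2
  have huu : Integrable (fun x => u x * u x) P.μV := h.memLp.integrable_mul h.memLp
  rw [energyNorm, norm_toLp_sq, norm_toLp_sq, h.rightDeriv_eq]
  congr 1
  have e1 := integral_center_mul hui hGi huG
  rw [hu, center_of_integral_eq_zero hG0, integral_aOp_mul hFi hGi, ← hF,
    center_of_integral_eq_zero hF0] at e1
  have e2 : ∀ x, (u x - G x) * u x = u x * u x - u x * G x := fun x => by ring
  simp only [e2]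
  rw [integral_sub huu huG, ← e1, sub_neg_eq_add]

theorem IsStrong.norm_deriv_le (h : P.IsStrong u F G) :
    ‖h.memLp_deriv.toLp F‖ ≤ P.energyNorm u := by
  rw [h.energyNorm_eq]
  exact Real.le_sqrt_of_sq_le (le_add_of_nonneg_left (sq_nonneg _))

theorem IsStrong.energyNorm_le (h : P.IsStrong u F G) :
    P.energyNorm u ≤ ‖h.memLp.toLp u‖ + ‖h.memLp_deriv.toLp F‖ := by
  rw [h.energyNorm_eq]
  refine Real.sqrt_le_iff.2 ⟨by positivity, ?_⟩
  nlinarith [norm_nonneg (h.memLp.toLp u), norm_nonneg (h.memLp_deriv.toLp F)]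

theorem IsStrong.centerLp_eq (h : P.IsStrong u F G) :
    centerLp P.μV (h.memLp.toLp u) = P.aLp (h.memLp_deriv.toLp F) := by
  refine Lp.ext ?_
  refine (coeFn_centerLp _).trans ((center_congr h.memLp.coeFn_toLp).trans ?_)
  rw [(center_eq_aOp h.cadlag h.caglad h.hasLeftDeriv).2, ← aOp_congr h.memLp_deriv.coeFn_toLp]
  exact (coeFn_aLp _).symm

theorem IsStrong.isSobolevDeriv (h : P.IsStrong u F G) :
    P.IsSobolevDeriv (h.memLp.toLp u) (h.memLp_deriv.toLp F) := by
  refine isSobolevDeriv_iff.2 ⟨?_, h.centerLp_eq⟩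
  rw [integral_congr_ae h.memLp_deriv.coeFn_toLp]
  exact (center_eq_aOp h.cadlag h.caglad h.hasLeftDeriv).1

end IsStrong

/-- The graph of the Sobolev derivative is closed. -/
theorem IsSobolevDeriv.of_tendsto {f : ℕ → Lp ℝ 2 P.μV} {F : ℕ → Lp ℝ 2 P.μW}
    {f₀ : Lp ℝ 2 P.μV} {F₀ : Lp ℝ 2 P.μW} (h : ∀ n, P.IsSobolevDeriv (f n) (F n))
    (hf : Tendsto f atTop (𝓝 f₀)) (hF : Tendsto F atTop (𝓝 F₀)) : P.IsSobolevDeriv f₀ F₀ := by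
  simp only [isSobolevDeriv_iff, ← inner_const_one] at h ⊢
  refine ⟨?_, ?_⟩
  · have h1 := (tendsto_const_nhds (x := Lp.const 2 P.μW (1 : ℝ))).inner (𝕜 := ℝ) hF
    simp only [(h _).1] at h1
    exact (tendsto_nhds_unique h1 tendsto_const_nhds)
  · have h1 := ((centerLp P.μV).continuous.tendsto _).comp hf
    have h2 := (P.aLp.continuous.tendsto _).comp hF
    exact tendsto_nhds_unique h1 (h2.congr fun n => ((h n).2).symm)

theorem tendsto_toLp_iff {u : ℕ → Circ → ℝ} (hu : ∀ n, MemLp (u n) 2 P.μV) {f : Lp ℝ 2 P.μV} :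
    Tendsto (fun n => (hu n).toLp (u n)) atTop (𝓝 f) ↔
      Tendsto (fun n => eLpNorm (fun x => u n x - f x) 2 P.μV) atTop (𝓝 0) := by
  have h := Lp.tendsto_Lp_iff_tendsto_eLpNorm'' (fi := atTop) u hu f (Lp.memLp f)
  rwa [Lp.toLp_coeFn] at h

/-- The derivatives of an admissible sequence are Cauchy in `L²_W`, and their limit is the Sobolev
derivative. -/
theorem exists_isSobolevDeriv_of_mem_sobolev {f : Lp ℝ 2 P.μV} (hf : f ∈ P.sobolev) :
    ∃ F, P.IsSobolevDeriv f F := by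
  obtain ⟨u, hu, hlim, hcau⟩ := hf
  have hs := fun n => isStrong_of_mem (hu n)
  set Φ : ℕ → Lp ℝ 2 P.μW := fun n => (hs n).memLp_deriv.toLp (leftDeriv P.W (u n)) with hΦ
  have hc : CauchySeq Φ := by
    refine Metric.cauchySeq_iff.2 fun ε hε => ?_
    obtain ⟨N, hN⟩ := hcau ε hε
    refine ⟨N, fun m hm n hn => ?_⟩
    rw [dist_eq_norm, hΦ, ← MemLp.toLp_sub]
    exact lt_of_le_of_lt ((hs m).sub (hs n)).norm_deriv_le (hN m hm n hn)
  obtain ⟨F, hF⟩ := cauchySeq_tendsto_of_complete hc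
  exact ⟨F, IsSobolevDeriv.of_tendsto (fun n => (hs n).isSobolevDeriv)
    ((tendsto_toLp_iff fun n => (hs n).memLp).2 hlim) hF⟩

/-- The primitives of the elements of the range of `smoothing` lie in `𝔇_{W,V}(𝕋)`. -/
theorem isStrong_aOp (F : Lp ℝ 2 P.μW) (c : ℝ) :
    P.IsStrong (fun x => P.aOp (P.smoothing F) x + c) (fun x => -P.bOp (P.aOp F) x)
      fun x => -P.aOp F x := by
  refine ⟨(cadlag_aOp (integrable_coe_Lp _)).add_const c,
    (hasLeftDeriv_aOp_smoothing F).add_const c, caglad_neg_bOp_aOp F,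
    hasRightDeriv_neg_bOp_aOp F, ?_⟩
  simpa using (cadlag_aOp (integrable_coe_Lp F)).const_mul (-1)

theorem toLp_deriv_isStrong_aOp (F : Lp ℝ 2 P.μW) (c : ℝ) :
    (isStrong_aOp F c).memLp_deriv.toLp _ = centerLp P.μW (P.smoothing F) :=
  Lp.ext ((isStrong_aOp F c).memLp_deriv.coeFn_toLp.trans
    ((center_smoothing F).symm.trans (coeFn_centerLp _).symm))

theorem toLp_isStrong_aOp (F : Lp ℝ 2 P.μW) (c : ℝ) :
    (isStrong_aOp F c).memLp.toLp _ = P.aLp (P.smoothing F) + Lp.const 2 P.μV c := by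
  refine Lp.ext ((isStrong_aOp F c).memLp.coeFn_toLp.trans ?_)
  filter_upwards [Lp.coeFn_add (P.aLp (P.smoothing F)) (Lp.const 2 P.μV c),
    coeFn_aLp (P.smoothing F), Lp.coeFn_const 2 P.μV c] with x h1 h2 h3
  rw [h1, Pi.add_apply, h2, h3, Function.const_apply]

/-- Approximating `F` in the range of `smoothing` approximates `f = A F + c` by elements of
`𝔇_{W,V}(𝕋)`. -/
theorem IsSobolevDeriv.mem_sobolev {f : Lp ℝ 2 P.μV} {F : Lp ℝ 2 P.μW}
    (h : P.IsSobolevDeriv f F) : f ∈ P.sobolev := by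
  obtain ⟨-, hc⟩ := isSobolevDeriv_iff_ae.1 h
  set c := (∫ x, f x ∂P.μV) / P.μV.real Set.univ with hcdef
  have hf : f = P.aLp F + Lp.const 2 P.μV c := by
    refine Lp.ext ?_
    filter_upwards [hc, Lp.coeFn_add (P.aLp F) (Lp.const 2 P.μV c), coeFn_aLp F,
      Lp.coeFn_const 2 P.μV c] with x h1 h2 h3 h4
    rw [h2, Pi.add_apply, h3, h4, ← h1, Function.const_apply, center, hcdef, sub_add_cancel]
  obtain ⟨y, hy, hylim⟩ := mem_closure_iff_seq_limit.1
    (denseRange_smoothing (P := P) F)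
  choose z hz using hy
  have hylim' : Tendsto (fun n => P.smoothing (z n)) atTop (𝓝 F) :=
    hylim.congr fun n => (hz n).symm
  have hs := fun n => isStrong_aOp (z n) c
  have hU : Tendsto (fun n => (hs n).memLp.toLp _) atTop (𝓝 f) := by
    rw [hf]
    exact (((P.aLp.continuous.tendsto _).comp hylim').add_const _).congr fun n =>
      (toLp_isStrong_aOp (z n) c).symm
  have hD : Tendsto (fun n => (hs n).memLp_deriv.toLp _) atTop (𝓝 (centerLp P.μW F)) :=
    (((centerLp P.μW).continuous.tendsto _).comp hylim').congr fun n =>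
      (toLp_deriv_isStrong_aOp (z n) c).symm
  refine ⟨fun n x => P.aOp (P.smoothing (z n)) x + c, fun n => (hs n).mem,
    (tendsto_toLp_iff fun n => (hs n).memLp).1 hU, fun ε hε => ?_⟩
  obtain ⟨N₁, h₁⟩ := Metric.cauchySeq_iff.1 hU.cauchySeq (ε / 2) (half_pos hε)
  obtain ⟨N₂, h₂⟩ := Metric.cauchySeq_iff.1 hD.cauchySeq (ε / 2) (half_pos hε)
  refine ⟨max N₁ N₂, fun m hm n hn => ?_⟩
  have h3 := h₁ m ((le_max_left _ _).trans hm) n ((le_max_left _ _).trans hn)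
  have h4 := h₂ m ((le_max_right _ _).trans hm) n ((le_max_right _ _).trans hn)
  rw [dist_eq_norm, ← MemLp.toLp_sub] at h3 h4
  refine lt_of_le_of_lt ((hs m).sub (hs n)).energyNorm_le ?_
  rw [← add_halves ε]
  exact add_lt_add h3 h4

theorem mem_sobolev_iff {f : Lp ℝ 2 P.μV} : f ∈ P.sobolev ↔ ∃ F, P.IsSobolevDeriv f F :=
  ⟨exists_isSobolevDeriv_of_mem_sobolev, fun ⟨_, h⟩ => h.mem_sobolev⟩

end Weights

end OneSided

end

theorem theorem5p1 (P : OneSided.Weights) :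
    P.weakSobolev = P.sobolev ∧
    ∀ f ∈ P.sobolev, ∃ F : MeasureTheory.Lp ℝ 2 P.μW,
      (∀ G : MeasureTheory.Lp ℝ 2 P.μW, P.IsWeakDeriv f G ↔ G = F) ∧
      (∀ G : MeasureTheory.Lp ℝ 2 P.μW, P.IsSobolevDeriv f G ↔ G = F) := by
  refine ⟨Set.ext fun f => ?_, fun f hf => ?_⟩
  · rw [OneSided.Weights.mem_sobolev_iff]
    exact ⟨fun ⟨F, _, hF⟩ => ⟨F, hF.isSobolevDeriv⟩, fun ⟨F, hF⟩ => ⟨F, hF.1, hF.isWeakDeriv⟩⟩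
  · obtain ⟨F, hF⟩ := OneSided.Weights.mem_sobolev_iff.1 hf
    have h : ∀ G, P.IsSobolevDeriv f G ↔ G = F := fun G =>
      ⟨fun hG => hG.unique hF, fun hG => hG ▸ hF⟩
    exact ⟨F, fun G => OneSided.Weights.isWeakDeriv_iff_isSobolevDeriv.trans (h G), h⟩
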